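/- **Setting.** $M\ge 1$ agents face a common linear bandit in $\mathbb R^d$ ($d\ge 1$) with action set $\{a\in\mathbb R^d:\|a\|_2\le 1\}$. If agent $j$ plays $a^j_t$ at time $t$, it receives $y^j_t=\langle\theta^*,a^j_t\rangle+\eta^j_t$, where $\theta^*$ is unknown, $\|\theta^*\|_2\le 1$, and the noise $\eta^j_t$ is zero-mean, i.i.d. over time and agents, with $\log\mathbb E[e^{\lambda\eta^j_t}]\le\lambda^2\sigma^2/2$ for all $\lambda\in\mathbb R$, where $\sigma>0$. Each agent plays $T\ge 1$ rounds, and the regret is $$R(T)=\sum_{j=1}^M\sum_{t=1}^T\Big[\max_{\|a\|_2\le1}\langle\theta^*,a\rangle-\langle\theta^*,a^j_t\rangle\Big].$$ **Parameters of PLS.** Let $0<\delta<1$ and $0<\alpha_0,\beta_0<1$. Put $K=\max\{k\ge1:40\sigma^2d\log(8Mk/\delta)(4^k-4)\le T\}$, $s_k=\lceil40\sigma^2d\log(8MK/\delta)4^k\rceil$, $\tau_k=3\cdot2^{-(k+1)}/\sqrt M$, $R_k=2^{-k}$, $B_1=1$, $B_k=5\tau_k$ for $k\ge2$, $\alpha_k=\alpha_0\sigma\sqrt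 d/\sqrt{s_k}$, $\beta_k=\beta_0\tau_k$. Fix any orthonormal basis of $\mathbb R^d$. **Clipping and quantization.** $\mathrm{Clip}(x,r)=x\min\{1,r/\|x\|_2\}$. For a scalar $y\in[-r,r]$ and resolution $\varepsilon$, divide $[-r,r]$ into $l=\lceil2r/\varepsilon\rceil$ equal intervals with end points $b_m=r(2m/l-1)$, $0\le m\le l$, and let $b_{m-1}\le y<b_m$ (for $y=r$, take $m=l$). $\mathrm{StoQuant}(y,\varepsilon,r)$ is $b_{m-1}$ with probability $(b_m-y)/(b_m-b_{m-1})$ and $b_m$ otherwise; $\mathrm{DetQuant}(y,\varepsilon,r)$ is the nearer of the two points ($b_m$ in a tie), and for $y\notin[-r,r]$ it is the nearer of $\pm r$. A vector is quantized in each coordinate with $\varepsilon/\sqrt d$ in place of $\varepsilon$; the quantization randomness is independent over coordinates, messages and agents, and of the noise. **Norm estimation.** In epochs $k=1,2,\dots$, each agent $j$ plays every basis vector $s_k$ times, forms the estimate $\hat\theta^{(j)}_k$ of $\theta^*$ from the sample means of the rewards, and sends $q^{(j)}_k=\mathrm{StoQuant}(\mathrm{Clip}(\hat\theta^{(j)}_k,R_k+B_k),\alpha_k,R_k+B_k)$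 to the server. The stage ends at the first epoch $k=k_0$ with $\tau_k\le\frac14\big\|\frac1M\sum_jq^{(j)}_k\big\|_2$. **Refinement.** Set $\bar\theta_{k_0-1}=0$. In epochs $k=k_0,k_0+1,\dots$, each agent again plays every basis vector $s_k$ times, forms $\hat\theta^{(j)}_k$ from the new rewards, and sends $q^{(j)}_k=\mathrm{StoQuant}(\mathrm{Clip}(\hat\theta^{(j)}_k-\bar\theta_{k-1},R_k+B_k),\alpha_k,R_k+B_k)$. The server broadcasts $Q_k=\mathrm{DetQuant}\big(\frac1M\sum_jq^{(j)}_k,\beta_k,B_k+\tau_k\big)$. All agents set $\bar\theta_k=\bar\theta_{k-1}+Q_k$ (and $\mu_0=\|\bar\theta_{k_0}\|_2$ when $k=k_0$) and play $\bar\theta_k/\|\bar\theta_k\|_2$ for $t_k=\lceil Ms_k^2\mu_0^2\rceil$ rounds. The whole procedure is stopped after $T$ rounds. **Theorem.** For all $\sigma,\alpha_0,\beta_0$ as above there is a constant $C>0$, independent of $d$, $M$ and $T$ (and of $\delta$, $\theta^*$, the basis and the noise law), such that with probability at least $1-\delta$ the regret of PLS satisfies $$R(T)\le C\,d\sqrt{MT}\,\log\Big(\frac{8MK}{\delta}\Big)\log\big(9\sqrt{MT}\big)+\mathcal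 O(\log T).$$ Here $\mathcal O(\log T)$ is, as $T\to\infty$, a function of $T$ that may depend on $d,M,\delta,\sigma,\alpha_0,\beta_0$ but not on $\theta^*$, the basis or the law of the noise. -/

import Mathlib

open MeasureTheory ProbabilityTheory Filter Asymptotics

noncomputable section

namespace PLS

/-- `ℝ^d` with the Euclidean norm and inner product. -/
abbrev E (d : ℕ) : Type := EuclideanSpace ℝ (Fin d)

/-- The numerical inputs of a run: the dimension `d`, the number of agents `M`, the horizon `T`
(rounds per agent), the noise parameter `σ`, the confidence level `δ`, and the two resolution
constants `α₀`, `β₀` of the quantizers. -/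
structure Params where
  d : ℕ
  M : ℕ
  T : ℕ
  σ : ℝ
  δ : ℝ
  α₀ : ℝ
  β₀ : ℝ

namespace Params

variable (p : Params)

/-- `K = max {k ≥ 1 : 40 σ² d log (8 M k / δ) (4^k - 4) ≤ T}`. For `d, M ≥ 1`, `σ > 0` and
`0 < δ < 1` the set is bounded, and it contains `1`. -/
def K : ℕ :=
  sSup {k : ℕ | 1 ≤ k ∧
    40 * p.σ ^ 2 * p.d * Real.log (8 * p.M * k / p.δ) * ((4 : ℝ) ^ k - 4) ≤ p.T}

/-- Number of plays of each basis vector in an exploration (sub-)epoch of index `k`. -/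
def s (k : ℕ) : ℕ :=
  ⌈40 * p.σ ^ 2 * p.d * Real.log (8 * p.M * p.K / p.δ) * (4 : ℝ) ^ k⌉₊

/-- Length of an exploitation sub-epoch of index `k`, given the norm estimate `μ₀`. -/
def t (k : ℕ) (μ₀ : ℝ) : ℕ := ⌈(p.M : ℝ) * (p.s k : ℝ) ^ 2 * μ₀ ^ 2⌉₊

/-- `τ_k = 3 · 2^{-(k+1)} / √M`. -/
def τ (k : ℕ) : ℝ := 3 * (2⁻¹ : ℝ) ^ (k + 1) / √(p.M : ℝ)

/-- `R_k = 2^{-k}`. -/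
def R (_p : Params) (k : ℕ) : ℝ := (2⁻¹ : ℝ) ^ k

/-- `B_1 = 1` and `B_k = 5 τ_k` for `k ≥ 2`. -/
def B (k : ℕ) : ℝ := if k = 1 then 1 else 5 * p.τ k

/-- Resolution of the uplink (stochastic) quantizer. -/
def α (k : ℕ) : ℝ := p.α₀ * p.σ * √(p.d : ℝ) / √(p.s k : ℝ)

/-- Resolution of the downlink (deterministic) quantizer. -/
def β (k : ℕ) : ℝ := p.β₀ * p.τ k

end Params

/-! ### Clipping and quantization -/

/-- `Clip (x, r) = x · min {1, r / ‖x‖}`. -/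
def clip {d : ℕ} (x : E d) (r : ℝ) : E d := min 1 (r / ‖x‖) • x

/-- Number of equal cells into which `[-r, r]` is divided at resolution `ε`. -/
def numCells (ε r : ℝ) : ℕ := ⌈2 * r / ε⌉₊

/-- The grid point `b_m = r (2 m / l - 1)`, where `l` is the number of cells. -/
def gridPt (ε r : ℝ) (m : ℕ) : ℝ := r * (2 * m / (numCells ε r : ℝ) - 1)

/-- The `c < l` with `b_c ≤ y < b_{c+1}`. The point `y = r` goes to the last cell, and values
outside `[-r, r]` go to the nearest extreme cell. -/
def cell (y ε r : ℝ) : ℕ :=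
  min (numCells ε r - 1) ⌊(y + r) * (numCells ε r : ℝ) / (2 * r)⌋₊

/-- Stochastic quantizer of a scalar, driven by a seed `u` (uniform on `[0, 1]`): the lower end
`b_c` of the cell of `y` is returned with probability `(b_{c+1} - y) / (b_{c+1} - b_c)`, the upper
end `b_{c+1}` otherwise. -/
def stoQuant (u y ε r : ℝ) : ℝ :=
  if u < (gridPt ε r (cell y ε r + 1) - y) /
      (gridPt ε r (cell y ε r + 1) - gridPt ε r (cell y ε r))
  then gridPt ε r (cell y ε r) else gridPt ε r (cell y ε r + 1)

/-- Deterministic quantizer of a scalar: the nearest end of the cell of `y`. -/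
def detQuant (y ε r : ℝ) : ℝ :=
  if |gridPt ε r (cell y ε r + 1) - y| > |gridPt ε r (cell y ε r) - y|
  then gridPt ε r (cell y ε r) else gridPt ε r (cell y ε r + 1)

/-- Coordinatewise stochastic quantization, with resolution `ε / √d` in each coordinate. -/
def stoQuantVec {d : ℕ} (u : Fin d → ℝ) (x : E d) (ε r : ℝ) : E d :=
  WithLp.toLp 2 fun i => stoQuant (u i) (x i) (ε / √(d : ℝ)) r

/-- Coordinatewise deterministic quantization, with resolution `ε / √d` in each coordinate. -/
def detQuantVec {d : ℕ} (x : E d) (ε r : ℝ) : E d :=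
  WithLp.toLp 2 fun i => detQuant (x i) (ε / √(d : ℝ)) r

/-! ### The bandit and the run of PLS on it -/

/-- A bandit instance together with one realization of all the randomness: the mean reward vector
`θ`, the orthonormal basis played in exploration, the noise `noise j t` in the reward of agent `j`
at time `t`, and the seed `seed j n i` with which agent `j` quantizes coordinate `i` of its `n`-th
message. Time starts at `0`. -/
structure World (d M : ℕ) where
  θ : E d
  basis : OrthonormalBasis (Fin d) ℝ (E d)
  noise : Fin M → ℕ → ℝ
  seed : Fin M → ℕ → Fin d → ℝ

/-- The reward of agent `j` when it plays `a` at time `t`. -/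
def World.reward {d M : ℕ} (w : World d M) (j : Fin M) (t : ℕ) (a : E d) : ℝ :=
  inner ℝ w.θ a + w.noise j t

/-- What agents and server know at the beginning of a phase. A phase is an epoch of norm estimation
or an epoch of refinement. -/
structure State (d : ℕ) where
  /-- index of the epoch that begins -/
  k : ℕ
  /-- time at which the phase begins -/
  start : ℕ
  /-- `none` in norm estimation; `some k₀` in refinement, `k₀` being the epoch index at which norm
  estimation was terminated -/
  k₀ : Option ℕ
  /-- `θ̄_{k-1}`, equal to `0` in norm estimation and when refinement begins -/
  θbar : E d
  /-- the norm estimate, set at the first update of refinement -/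
  μ₀ : ℝ

variable (p : Params) (w : World p.d p.M)

/-- The estimate of agent `j` from the exploration that begins at `S.start`: the basis vectors are
played one after the other, `s_k` times each, and the rewards of each are averaged. -/
def localEstimate (S : State p.d) (j : Fin p.M) : E p.d :=
  ∑ i : Fin p.d,
    ((∑ m ∈ Finset.range (p.s S.k),
        w.reward j (S.start + (i : ℕ) * p.s S.k + m) (w.basis i)) / (p.s S.k : ℝ)) • w.basis i

/-- The message of agent `j` to the server in phase `n`. -/
def uplink (n : ℕ) (S : State p.d) (j : Fin p.M) : E p.d :=
  stoQuantVec (w.seed j n) (clip (localEstimate p w S j - S.θbar) (p.R S.k + p.B S.k))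
    (p.α S.k) (p.R S.k + p.B S.k)

/-- The estimate of the server. -/
def serverEstimate (n : ℕ) (S : State p.d) : E p.d :=
  S.θbar + (1 / (p.M : ℝ)) • ∑ j : Fin p.M, uplink p w n S j

/-- The message of the server to all agents in refinement. -/
def downlink (n : ℕ) (S : State p.d) : E p.d :=
  detQuantVec (serverEstimate p w n S - S.θbar) (p.β S.k) (p.B S.k + p.τ S.k)

open Classical in
/-- One phase. In norm estimation: explore, then either terminate (refinement then begins with the
same epoch index) or go on to the next epoch. In refinement: explore, update `θ̄`, set `μ₀` if
`k = k₀`, and exploit for `t_k` rounds. -/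
def step (n : ℕ) (S : State p.d) : State p.d :=
  match S.k₀ with
  | none =>
      { k := if p.τ S.k ≤ 1 / 4 * ‖serverEstimate p w n S‖ then S.k else S.k + 1
        start := S.start + p.d * p.s S.k
        k₀ := if p.τ S.k ≤ 1 / 4 * ‖serverEstimate p w n S‖ then some S.k else none
        θbar := 0
        μ₀ := 0 }
  | some k₀ =>
      let θnew := S.θbar + downlink p w n S
      let μ := if S.k = k₀ then ‖θnew‖ else S.μ₀
      { k := S.k + 1
        start := S.start + p.d * p.s S.k + p.t S.k μ
        k₀ := some k₀
        θbar := θnew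
        μ₀ := μ }

/-- The state at the beginning of phase `n = 0, 1, 2, …`. -/
def state : ℕ → State p.d
  | 0 => { k := 1, start := 0, k₀ := none, θbar := 0, μ₀ := 0 }
  | n + 1 => step p w n (state n)

/-- The phase to which time `t` belongs. -/
def phase (t : ℕ) : ℕ := Nat.findGreatest (fun n => (state p w n).start ≤ t) t

open Classical in
/-- The action of agent `j` at time `t`: in the first `d s_k` rounds of its phase a basis vector,
afterwards (in refinement only) the unit vector along the updated estimate `θ̄_k`. -/
def action (_j : Fin p.M) (t : ℕ) : E p.d :=
  let S := state p w (phase p w t)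
  if h : (t - S.start) / p.s S.k < p.d then w.basis ⟨(t - S.start) / p.s S.k, h⟩
  else ‖(state p w (phase p w t + 1)).θbar‖⁻¹ • (state p w (phase p w t + 1)).θbar

/-- The overall cumulative regret of PLS over the `T` rounds; the action set is the unit ball. -/
def regret : ℝ :=
  ∑ j : Fin p.M, ∑ t ∈ Finset.range p.T,
    (sSup ((fun a : E p.d => inner ℝ w.θ a) '' Metric.closedBall 0 1)
      - inner ℝ w.θ (action p w j t))

/-! ### The randomness -/

/-- The noise variables `η j t` are i.i.d., with mean zero and `σ²`-sub-Gaussian; the quantization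
seeds `U j n i` are uniform on `[0, 1]`; and all these variables are jointly independent. -/
structure IsRandomness {d M : ℕ} {Ω : Type*} [MeasurableSpace Ω] (P : Measure Ω) (σ : ℝ)
    (η : Fin M → ℕ → Ω → ℝ) (U : Fin M → ℕ → Fin d → Ω → ℝ) : Prop where
  measurable_noise : ∀ j t, Measurable (η j t)
  measurable_seed : ∀ j n i, Measurable (U j n i)
  indep : iIndepFun
    (Sum.elim (fun a : Fin M × ℕ => η a.1 a.2)
      (fun a : Fin M × ℕ × Fin d => U a.1 a.2.1 a.2.2)) P
  identDistrib : ∀ j t j' t', IdentDistrib (η j t) (η j' t') P P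
  mean_zero : ∀ j t, ∫ ω, η j t ω ∂P = 0
  subgaussian : ∀ j t, HasSubgaussianMGF (η j t) (Real.toNNReal (σ ^ 2)) P
  uniform_seed : ∀ j n i, pdf.IsUniform (U j n i) (Set.Icc (0 : ℝ) 1) P

end PLS

end

/-! Call a phase good if three kinds of sums are small in it: the noise of each agent over each
block of plays, that noise summed over the agents, and the summed uplink quantization error
(`GoodPhase`). In a good phase of index `k` every local estimate is within `R_k / 4` of `θ`, and
after averaging over agents noise and quantization together contribute at most `τ_k / 4`. The only
other error of the server is the bias of clipping, which vanishes when `‖θ - θ̄‖ ≤ B_k + (3/4) R_k`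
(`GoodPhase.norm_serverResidual_sub`).

On good phases the run is controlled deterministically by an induction (`Invariant`). A failed norm
test leaves `‖θ‖ ≤ (17/2) τ` for the next index. A passed test gives `‖θ‖ ≥ (15/4) τ_k`. In
refinement the residual error is at most `(17/2) τ_k` when epoch `k` begins and at most half of that
after its update, and `μ₀` is comparable to `‖θ‖`.

Each phase then costs `O(d L √(MT))`, where `L = log (8MK/δ)`. Exploration is cheap either because
`‖θ‖ = O(τ_k)`, or because the preceding exploitation, whose length is about `M s² μ₀²`, already
fitted into `T` rounds. Exploitation is cheap because the loss of playing the direction of an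
estimate is quadratic in its error (`norm_mul_gap_le`). Exploration lengths grow like `4^k`, so the
`T` rounds meet only phases of index below `K + 3`, and `K = O(log (9 √(MT)))` for large `T`.

For the probability of a good run, the noise block of a phase sits at a random time. The start of a
phase acts as a stopping time (`stateOf_congr`), so freezing its countably many values reduces the
tail bound to independent blocks (`measure_le_of_countable_split`). The seeds of a phase are
independent of all that is quantized in it, so Fubini and Hoeffding bounds apply. Each failure has
probability at most `2 exp (-(5/4) L)`. The excess `exp (-L/4)` pays for the union over `d`
coordinates once `K ≥ 81 d^4`. The finitely many smaller horizons are left to the `O(log T)` term.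
-/

namespace PLS

/-! ### Norms, clipping and directions -/

theorem norm_le_norm_add_of_abs_le {d : ℕ} {x y : E d} {c : ℝ} (hc : 0 ≤ c)
    (h : ∀ i, |x i| ≤ |y i| + c) : ‖x‖ ≤ ‖y‖ + √(d : ℝ) * c := by
  have h1 : ‖x‖ ≤ ‖(WithLp.toLp 2 (fun i => |y i|) : E d) + WithLp.toLp 2 (fun _ => c)‖ := by
    rw [EuclideanSpace.norm_eq, EuclideanSpace.norm_eq]
    refine Real.sqrt_le_sqrt (Finset.sum_le_sum fun i _ => ?_)
    have : 0 ≤ |y i| + c := by positivity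
    simp only [Real.norm_eq_abs, PiLp.add_apply, abs_of_nonneg this]
    exact pow_le_pow_left₀ (abs_nonneg _) (h i) 2
  have h2 : ‖(WithLp.toLp 2 (fun i => |y i|) : E d)‖ = ‖y‖ := by
    simp [EuclideanSpace.norm_eq]
  have h3 : ‖(WithLp.toLp 2 (fun _ => c) : E d)‖ = √(d : ℝ) * c := by
    simp [EuclideanSpace.norm_eq, Real.sqrt_sq hc]
  calc ‖x‖ ≤ _ := h1
    _ ≤ _ := norm_add_le _ _
    _ = _ := by rw [h2, h3]

theorem norm_le_of_abs_le {d : ℕ} {x : E d} {c : ℝ} (hc : 0 ≤ c)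
    (h : ∀ i, |x i| ≤ c) : ‖x‖ ≤ √(d : ℝ) * c := by
  simpa using norm_le_norm_add_of_abs_le (x := x) (y := 0) hc (by simpa using h)

theorem clip_eq_self {d : ℕ} {x : E d} {r : ℝ} (h : ‖x‖ ≤ r) : clip x r = x := by
  rcases eq_or_ne x 0 with rfl | hx
  · simp [clip]
  · have : 0 < ‖x‖ := norm_pos_iff.2 hx
    have h1 : 1 ≤ r / ‖x‖ := (one_le_div this).2 h
    simp [clip, min_eq_left h1]

theorem norm_clip_le {d : ℕ} (x : E d) {r : ℝ} (hr : 0 ≤ r) : ‖clip x r‖ ≤ r := by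
  rcases eq_or_ne x 0 with rfl | hx
  · simpa [clip] using hr
  · have h0 : 0 < ‖x‖ := norm_pos_iff.2 hx
    have h1 : 0 ≤ min 1 (r / ‖x‖) := le_min zero_le_one (by positivity)
    rw [clip, norm_smul, Real.norm_of_nonneg h1]
    calc min 1 (r / ‖x‖) * ‖x‖ ≤ r / ‖x‖ * ‖x‖ := by gcongr; exact min_le_right _ _
      _ = r := by field_simp

theorem norm_sub_clip_le {d : ℕ} (x : E d) {r : ℝ} (hr : 0 ≤ r) :
    ‖x - clip x r‖ ≤ max (‖x‖ - r) 0 := by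
  rcases le_or_gt ‖x‖ r with h | h
  · simp [clip_eq_self h]
  · have h0 : 0 < ‖x‖ := hr.trans_lt h
    have h1 : r / ‖x‖ ≤ 1 := (div_le_one h0).2 h.le
    have h2 : x - clip x r = (1 - r / ‖x‖) • x := by
      rw [clip, min_eq_right h1, sub_smul, one_smul]
    rw [h2, norm_smul, Real.norm_of_nonneg (by linarith)]
    refine le_max_of_le_left (le_of_eq ?_)
    field_simp

theorem abs_apply_le_norm {d : ℕ} (x : E d) (i : Fin d) : |x i| ≤ ‖x‖ := by
  simpa using PiLp.norm_apply_le x i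

theorem abs_clip_apply_le {d : ℕ} (x : E d) {r : ℝ} (hr : 0 ≤ r) (i : Fin d) :
    |clip x r i| ≤ r := (abs_apply_le_norm _ i).trans (norm_clip_le x hr)

theorem norm_orthonormalBasis_sum_le {d : ℕ} (b : OrthonormalBasis (Fin d) ℝ (E d))
    {x : Fin d → ℝ} {c : ℝ} (hc : 0 ≤ c) (h : ∀ i, |x i| ≤ c) :
    ‖∑ i, x i • b i‖ ≤ √(d : ℝ) * c := by
  have h1 : ∑ i, x i • b i = b.repr.symm (WithLp.toLp 2 x) := by
    rw [OrthonormalBasis.sum_repr_symm]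
  rw [h1, LinearIsometryEquiv.norm_map]
  exact norm_le_of_abs_le hc h

/-- Playing the direction of an estimate `b` of `θ` costs quadratically in the error. -/
theorem norm_mul_gap_le {d : ℕ} (θ b : E d) :
    ‖θ‖ * (‖θ‖ - inner ℝ θ (‖b‖⁻¹ • b)) ≤ 2 * ‖θ - b‖ ^ 2 := by
  rcases eq_or_ne b 0 with rfl | hb
  -- For `b = 0` the convention `0⁻¹ = 0` makes the action `0`, and the gap is `‖θ‖`.
  · simp; nlinarith [norm_nonneg θ]
  have hb' : 0 < ‖b‖ := norm_pos_iff.2 hb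
  set c : ℝ := inner ℝ θ (‖b‖⁻¹ • b) with hc
  have hcb : inner ℝ θ b = c * ‖b‖ := by
    rw [hc, inner_smul_right]; field_simp
  have h1 : ‖θ - b‖ ^ 2 = ‖θ‖ ^ 2 - 2 * (c * ‖b‖) + ‖b‖ ^ 2 := by
    rw [norm_sub_sq_real, hcb]
  have hcle : |c| ≤ ‖θ‖ := by
    have := abs_real_inner_le_norm θ (‖b‖⁻¹ • b)
    rwa [norm_smul, norm_inv, norm_norm, inv_mul_cancel₀ hb'.ne', mul_one] at this
  have := abs_le.1 hcle
  rw [h1]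
  -- `‖θ - b‖² = (‖θ‖² - c²) + (c - ‖b‖)²`. If `c ≥ 0`, then `‖θ‖ (‖θ‖ - c) ≤ ‖θ‖² - c²`. If `c <
  -- 0`, then `‖θ - b‖ ≥ ‖θ‖`, while the gap is at most `2 ‖θ‖`.
  rcases le_or_gt 0 c with h | h
  · nlinarith [sq_nonneg (c - ‖b‖), sq_nonneg (‖θ‖ - c), norm_nonneg θ]
  · nlinarith [mul_pos (neg_pos.2 h) hb', norm_nonneg θ]

/-! ### Scalar and vector quantizers -/

theorem numCells_pos {ε r : ℝ} (hε : 0 < ε) (hr : 0 < r) : 0 < numCells ε r :=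
  Nat.ceil_pos.2 (by positivity)

theorem gridPt_succ_sub {ε r : ℝ} (hε : 0 < ε) (hr : 0 < r) (m : ℕ) :
    gridPt ε r (m + 1) - gridPt ε r m = 2 * r / numCells ε r := by
  have : (0 : ℝ) < numCells ε r := by exact_mod_cast numCells_pos hε hr
  simp only [gridPt]; push_cast; field_simp; ring

theorem gridPt_width_pos {ε r : ℝ} (hε : 0 < ε) (hr : 0 < r) (m : ℕ) :
    0 < gridPt ε r (m + 1) - gridPt ε r m := by
  have : (0 : ℝ) < numCells ε r := by exact_mod_cast numCells_pos hε hr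
  rw [gridPt_succ_sub hε hr]; positivity

theorem gridPt_width_le {ε r : ℝ} (hε : 0 < ε) (hr : 0 < r) (m : ℕ) :
    gridPt ε r (m + 1) - gridPt ε r m ≤ ε := by
  have : (0 : ℝ) < numCells ε r := by exact_mod_cast numCells_pos hε hr
  rw [gridPt_succ_sub hε hr, div_le_iff₀ this]
  have := Nat.le_ceil (2 * r / ε)
  rw [div_le_iff₀ hε] at this
  rw [numCells]; linarith

theorem cell_mem {y ε r : ℝ} (hε : 0 < ε) (hr : 0 < r) (hy : |y| ≤ r) :
    gridPt ε r (cell y ε r) ≤ y ∧ y ≤ gridPt ε r (cell y ε r + 1) := by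
  have hl : 0 < numCells ε r := numCells_pos hε hr
  have hl' : (0 : ℝ) < numCells ε r := by exact_mod_cast hl
  obtain ⟨h1, h2⟩ := abs_le.1 hy
  set q : ℝ := (y + r) * (numCells ε r : ℝ) / (2 * r) with hq
  have hq0 : 0 ≤ q := by
    have : 0 ≤ y + r := by linarith
    positivity
  have hyq : y = r * (2 * q / (numCells ε r : ℝ) - 1) := by
    rw [hq]; field_simp; ring
  have hql : q ≤ numCells ε r := by
    rw [hq, div_le_iff₀ (by positivity)]; nlinarith
  have key : ∀ x x' : ℝ, x ≤ x' →
      r * (2 * x / (numCells ε r : ℝ) - 1) ≤ r * (2 * x' / (numCells ε r : ℝ) - 1) := by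
    intro x x' h; gcongr
  constructor
  · conv_rhs => rw [hyq]
    refine key _ _ ?_
    calc ((cell y ε r : ℕ) : ℝ) ≤ (⌊q⌋₊ : ℝ) := by exact_mod_cast min_le_right _ _
      _ ≤ q := Nat.floor_le hq0
  · conv_lhs => rw [hyq]
    refine key _ _ ?_
    rcases le_total (numCells ε r - 1) ⌊q⌋₊ with h | h
    · have : cell y ε r + 1 = numCells ε r := by
        rw [cell, ← hq, min_eq_left h]; omega
      rw [this]; exact hql
    · have : cell y ε r = ⌊q⌋₊ := by rw [cell, ← hq, min_eq_right h]
      rw [this]; push_cast; exact (Nat.lt_floor_add_one q).le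

theorem abs_detQuant_sub_le {y ε r : ℝ} (hε : 0 < ε) (hr : 0 < r) (hy : |y| ≤ r) :
    |detQuant y ε r - y| ≤ ε / 2 := by
  obtain ⟨h1, h2⟩ := cell_mem hε hr hy
  have h3 := gridPt_width_le hε hr (cell y ε r)
  rw [detQuant]
  rw [abs_of_nonneg (sub_nonneg.2 h2), abs_of_nonpos (sub_nonpos.2 h1)]
  split_ifs with h
  · rw [abs_of_nonpos (sub_nonpos.2 h1)]; linarith
  · rw [abs_of_nonneg (sub_nonneg.2 h2)]; linarith

theorem gridPt_numCells {ε r : ℝ} (hε : 0 < ε) (hr : 0 < r) :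
    gridPt ε r (numCells ε r) = r := by
  have : (0 : ℝ) < numCells ε r := by exact_mod_cast numCells_pos hε hr
  simp only [gridPt]; field_simp; ring

theorem gridPt_zero (ε r : ℝ) : gridPt ε r 0 = -r := by
  simp [gridPt]

theorem detQuant_of_lt {y ε r : ℝ} (hε : 0 < ε) (hr : 0 < r) (hy : r < y) :
    detQuant y ε r = r := by
  have hl : 0 < numCells ε r := numCells_pos hε hr
  have hl' : (0 : ℝ) < numCells ε r := by exact_mod_cast hl
  have hc : cell y ε r = numCells ε r - 1 := by
    refine min_eq_left ((Nat.sub_le _ _).trans (Nat.le_floor ?_))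
    rw [le_div_iff₀ (by positivity)]; nlinarith
  have hw := gridPt_width_pos hε hr (cell y ε r)
  have hc1 : cell y ε r + 1 = numCells ε r := by omega
  rw [detQuant]
  rw [hc1, gridPt_numCells hε hr] at hw ⊢
  rw [abs_of_neg (by linarith), abs_of_neg (by linarith), if_neg (by linarith)]

theorem detQuant_of_lt_neg {y ε r : ℝ} (hε : 0 < ε) (hr : 0 < r) (hy : y < -r) :
    detQuant y ε r = -r := by
  have hl : 0 < numCells ε r := numCells_pos hε hr
  have hl' : (0 : ℝ) < numCells ε r := by exact_mod_cast hl
  have hc : cell y ε r = 0 := by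
    have : ⌊(y + r) * (numCells ε r : ℝ) / (2 * r)⌋₊ = 0 := by
      refine Nat.floor_of_nonpos (div_nonpos_of_nonpos_of_nonneg ?_ (by positivity))
      nlinarith
    simp [cell, this]
  have hw := gridPt_width_pos hε hr 0
  rw [detQuant, hc]
  rw [gridPt_zero] at hw ⊢
  rw [abs_of_pos (by linarith), abs_of_pos (by linarith), if_pos (by linarith)]

/-- All coordinates of the Euclidean clip lie in `[-r, r]`, so sending an overflowing coordinate to
`±r` moves it no further than clipping does. The overflow therefore costs at most `‖y - clip y r‖`,
with no factor `√d`. -/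
theorem norm_detQuantVec_sub_le {d : ℕ} (hd : 1 ≤ d) (y : E d) {ε r : ℝ} (hε : 0 < ε)
    (hr : 0 < r) : ‖detQuantVec y ε r - y‖ ≤ max (‖y‖ - r) 0 + ε / 2 := by
  have hd0 : (0 : ℝ) < √(d : ℝ) := Real.sqrt_pos.2 (by exact_mod_cast hd)
  have hε' : 0 < ε / √(d : ℝ) := by positivity
  have key : ∀ i, |(detQuantVec y ε r - y) i| ≤ |(y - clip y r) i| + ε / √(d : ℝ) / 2 := by
    intro i
    have hcl := abs_le.1 (abs_clip_apply_le y hr.le i)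
    simp only [detQuantVec, PiLp.sub_apply]
    rcases le_or_gt |y i| r with h | h
    · have := abs_detQuant_sub_le hε' hr h
      have := abs_nonneg (y i - clip y r i)
      linarith
    · have hp : 0 ≤ ε / √(d : ℝ) / 2 := by positivity
      rcases lt_abs.1 h with h | h
      · rw [detQuant_of_lt hε' hr h, abs_of_neg (by linarith), abs_of_pos (by linarith)]
        linarith
      · rw [detQuant_of_lt_neg hε' hr (by linarith), abs_of_pos (by linarith),
          abs_of_neg (by linarith)]
        linarith
  refine (norm_le_norm_add_of_abs_le (by positivity) key).trans ?_
  have : √(d : ℝ) * (ε / √(d : ℝ) / 2) = ε / 2 := by field_simp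
  rw [this]
  gcongr
  exact norm_sub_clip_le y hr.le

/-- Truncating a coordinate of `y` to `[-r, r]` can only move it away from `v` by the amount by
which `v` itself overflows. Unlike the previous bound, the overflow is measured at the target `v`,
which helps when `y` may be long but `v` is short. -/
theorem norm_detQuantVec_sub_le_of_near {d : ℕ} (hd : 1 ≤ d) (y v : E d) {ε r : ℝ} (hε : 0 < ε)
    (hr : 0 < r) : ‖detQuantVec y ε r - v‖ ≤ ‖y - v‖ + max (‖v‖ - r) 0 + ε / 2 := by
  have hd0 : (0 : ℝ) < √(d : ℝ) := Real.sqrt_pos.2 (by exact_mod_cast hd)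
  have hε' : 0 < ε / √(d : ℝ) := by positivity
  set z : E d := WithLp.toLp 2 (fun i => |(y - v) i|) +
    WithLp.toLp 2 (fun i => |(v - clip v r) i|) with hz
  have hzn : ‖z‖ ≤ ‖y - v‖ + ‖v - clip v r‖ := by
    refine (norm_add_le _ _).trans (le_of_eq ?_)
    congr 1 <;> simp [EuclideanSpace.norm_eq]
  have key : ∀ i, |(detQuantVec y ε r - v) i| ≤ |z i| + ε / √(d : ℝ) / 2 := by
    intro i
    have hcl := abs_le.1 (abs_clip_apply_le v hr.le i)
    have hp : 0 ≤ ε / √(d : ℝ) / 2 := by positivity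
    have hzi : |z i| = |y i - v i| + |v i - clip v r i| := by
      simp only [hz, PiLp.add_apply, PiLp.sub_apply]
      exact abs_of_nonneg (by positivity)
    rw [hzi]
    have h1 := neg_abs_le (y i - v i)
    have h2 := le_abs_self (y i - v i)
    have h3 := neg_abs_le (v i - clip v r i)
    have h4 := le_abs_self (v i - clip v r i)
    simp only [detQuantVec, PiLp.sub_apply]
    rcases le_or_gt |y i| r with h | h
    · have := abs_le.1 (abs_detQuant_sub_le hε' hr h)
      exact abs_le.2 ⟨by linarith, by linarith⟩
    · rcases lt_abs.1 h with h | h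
      · rw [detQuant_of_lt hε' hr h]
        exact abs_le.2 ⟨by linarith, by linarith⟩
      · rw [detQuant_of_lt_neg hε' hr (by linarith)]
        exact abs_le.2 ⟨by linarith, by linarith⟩
  refine (norm_le_norm_add_of_abs_le (by positivity) key).trans ?_
  have : √(d : ℝ) * (ε / √(d : ℝ) / 2) = ε / 2 := by field_simp
  rw [this]
  have := norm_sub_clip_le v hr.le
  linarith


/-! ### Parameters of a run, and the errors of a good phase -/

section

namespace Params

/-- The ranges of the parameters. -/
structure Valid (p : Params) : Prop where
  d_pos : 1 ≤ p.d
  M_pos : 1 ≤ p.M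
  σ_pos : 0 < p.σ
  δ_pos : 0 < p.δ
  δ_lt : p.δ < 1
  α_pos : 0 < p.α₀
  α_lt : p.α₀ < 1
  β_pos : 0 < p.β₀
  β_lt : p.β₀ < 1

/-- The logarithmic factor `log (8 M K / δ)`. -/
noncomputable def L (p : Params) : ℝ := Real.log (8 * p.M * p.K / p.δ)



theorem Valid.d_cast {p : Params} (hp : p.Valid) : (1 : ℝ) ≤ p.d := by exact_mod_cast hp.d_pos

theorem Valid.M_cast {p : Params} (hp : p.Valid) : (1 : ℝ) ≤ p.M := by exact_mod_cast hp.M_pos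

theorem Valid.sqrt_M_pos {p : Params} (hp : p.Valid) : 0 < √(p.M : ℝ) :=
  Real.sqrt_pos.2 (by linarith [hp.M_cast])

theorem Valid.one_le_sqrt_M {p : Params} (hp : p.Valid) : 1 ≤ √(p.M : ℝ) :=
  Real.one_le_sqrt.2 hp.M_cast

theorem Valid.eight_mul_le {p : Params} (hp : p.Valid) {k : ℕ} (hk : 1 ≤ k) :
    (8 : ℝ) * k ≤ 8 * p.M * k / p.δ := by
  have h1 := hp.M_cast
  have h2 := hp.δ_pos
  have h3 := hp.δ_lt
  have h4 : (1 : ℝ) ≤ k := by exact_mod_cast hk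
  rw [le_div_iff₀ h2]
  nlinarith [mul_pos h2 (show (0 : ℝ) < k by linarith), mul_nonneg (sub_nonneg.2 h1)
    (show (0 : ℝ) ≤ k by linarith)]

theorem Valid.one_le_log {p : Params} (hp : p.Valid) {k : ℕ} (hk : 1 ≤ k) :
    1 ≤ Real.log (8 * p.M * k / p.δ) := by
  have h4 : (1 : ℝ) ≤ k := by exact_mod_cast hk
  have h := hp.eight_mul_le hk
  rw [Real.le_log_iff_exp_le (by linarith)]
  linarith [Real.exp_one_lt_d9]

/-- Needed to give `K` its meaning: `sSup` of an unbounded set of naturals is `0` by convention. -/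
theorem Valid.bddAbove {p : Params} (hp : p.Valid) : BddAbove {k : ℕ | 1 ≤ k ∧
    40 * p.σ ^ 2 * p.d * Real.log (8 * p.M * k / p.δ) * ((4 : ℝ) ^ k - 4) ≤ p.T} := by
  refine ⟨⌈(p.T : ℝ) / (40 * p.σ ^ 2) + 4⌉₊, fun k ⟨hk, h⟩ => ?_⟩
  have hσ := hp.σ_pos
  have hd := hp.d_cast
  have hl := hp.one_le_log hk
  have h4 : (4 : ℝ) ≤ 4 ^ k := by
    calc (4 : ℝ) = 4 ^ 1 := by norm_num
      _ ≤ 4 ^ k := pow_le_pow_right₀ (by norm_num) hk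
  have hk4 : (k : ℝ) ≤ 4 ^ k := by exact_mod_cast (Nat.lt_pow_self (by norm_num)).le
  have h1 : 40 * p.σ ^ 2 * ((4 : ℝ) ^ k - 4) ≤ p.T := by
    refine le_trans ?_ h
    have : (1 : ℝ) ≤ p.d * Real.log (8 * p.M * k / p.δ) := one_le_mul_of_one_le_of_one_le hd hl
    have h0 : 0 ≤ 40 * p.σ ^ 2 * ((4 : ℝ) ^ k - 4) := by
      have : 0 ≤ (4 : ℝ) ^ k - 4 := by linarith
      positivity
    nlinarith
  have h2 : (4 : ℝ) ^ k - 4 ≤ p.T / (40 * p.σ ^ 2) := by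
    rw [le_div_iff₀ (by positivity)]; linarith
  have : (k : ℝ) ≤ ⌈(p.T : ℝ) / (40 * p.σ ^ 2) + 4⌉₊ := by
    refine le_trans ?_ (Nat.le_ceil _); linarith
  exact_mod_cast this

theorem Valid.le_K {p : Params} (hp : p.Valid) {k : ℕ} (hk : 1 ≤ k)
    (h : 40 * p.σ ^ 2 * p.d * Real.log (8 * p.M * k / p.δ) * ((4 : ℝ) ^ k - 4) ≤ p.T) :
    k ≤ p.K := le_csSup hp.bddAbove ⟨hk, h⟩

theorem Valid.one_le_K {p : Params} (hp : p.Valid) : 1 ≤ p.K :=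
  hp.le_K le_rfl (by norm_num)

theorem Valid.K_spec {p : Params} (hp : p.Valid) :
    40 * p.σ ^ 2 * p.d * p.L * ((4 : ℝ) ^ p.K - 4) ≤ p.T :=
  (Nat.sSup_mem ⟨1, by norm_num⟩ hp.bddAbove).2

/-- `K + 1` violates the defining inequality of `K`. Passing from `K` to `K + 1` at most doubles the
logarithm: its argument `x ≥ 8` becomes at most `2x ≤ x²`. -/
theorem Valid.lt_of_K {p : Params} (hp : p.Valid) :
    (p.T : ℝ) < 40 * p.σ ^ 2 * p.d * (2 * p.L) * (4 : ℝ) ^ (p.K + 1) := by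
  have hσ := hp.σ_pos
  have hd := hp.d_cast
  have hM := hp.M_cast
  have hK : (1 : ℝ) ≤ p.K := by exact_mod_cast hp.one_le_K
  by_contra! h
  refine absurd (hp.le_K (k := p.K + 1) (by omega) (le_trans ?_ h)) (by omega)
  have hx := hp.eight_mul_le hp.one_le_K
  have hl := hp.one_le_log (k := p.K + 1) (by omega)
  have h2 : Real.log (8 * p.M * (p.K + 1 : ℕ) / p.δ) ≤ 2 * p.L := by
    have e : 2 * p.L = Real.log ((8 * p.M * p.K / p.δ) ^ 2) := by
      rw [Real.log_pow, L]; norm_num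
    rw [e]
    push_cast
    refine Real.log_le_log (by have := hp.δ_pos; positivity) ?_
    have : 8 * p.M * (p.K + 1 : ℝ) / p.δ ≤ 2 * (8 * p.M * p.K / p.δ) := by
      rw [mul_div_assoc', div_le_div_iff_of_pos_right hp.δ_pos]
      nlinarith
    nlinarith
  have h3 : (4 : ℝ) ^ (p.K + 1) - 4 ≤ 4 ^ (p.K + 1) := by linarith
  have h4 : 0 ≤ (4 : ℝ) ^ (p.K + 1) - 4 := by
    have : (4 : ℝ) ^ 1 ≤ 4 ^ (p.K + 1) := pow_le_pow_right₀ (by norm_num) (by omega)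
    linarith
  have h5 : 0 ≤ p.L := by linarith [show 1 ≤ p.L from hp.one_le_log hp.one_le_K]
  calc _ ≤ 40 * p.σ ^ 2 * p.d * (2 * p.L) * ((4 : ℝ) ^ (p.K + 1) - 4) := by gcongr
    _ ≤ _ := by gcongr

theorem Valid.one_le_L {p : Params} (hp : p.Valid) : 1 ≤ p.L := hp.one_le_log hp.one_le_K

theorem le_s (p : Params) (k : ℕ) :
    40 * p.σ ^ 2 * p.d * p.L * (4 : ℝ) ^ k ≤ p.s k := Nat.le_ceil _

theorem Valid.s_pos {p : Params} (hp : p.Valid) (k : ℕ) : 0 < p.s k := by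
  have hσ := hp.σ_pos
  have hd := hp.d_cast
  have hl := hp.one_le_L
  refine Nat.ceil_pos.2 ?_
  have : 0 < 40 * p.σ ^ 2 * p.d * p.L * (4 : ℝ) ^ k := by positivity
  exact this

theorem Valid.s_cast_pos {p : Params} (hp : p.Valid) (k : ℕ) : (0 : ℝ) < p.s k := by
  exact_mod_cast hp.s_pos k

theorem Valid.s_le {p : Params} (hp : p.Valid) (k : ℕ) :
    (p.s k : ℝ) ≤ 4 ^ k * (p.d * p.L * (40 * p.σ ^ 2 + 1)) := by
  have hσ := hp.σ_pos
  have hd := hp.d_cast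
  have hl := hp.one_le_L
  have h1 : (p.s k : ℝ) < 40 * p.σ ^ 2 * p.d * p.L * (4 : ℝ) ^ k + 1 :=
    Nat.ceil_lt_add_one (by have : 0 ≤ p.L := by linarith
                            change 0 ≤ 40 * p.σ ^ 2 * p.d * p.L * (4 : ℝ) ^ k
                            positivity)
  have h2 : (1 : ℝ) ≤ 4 ^ k := one_le_pow₀ (by norm_num)
  have h3 : (1 : ℝ) ≤ p.d * p.L := one_le_mul_of_one_le_of_one_le hd hl
  have h4 : (1 : ℝ) ≤ 4 ^ k * (p.d * p.L) := one_le_mul_of_one_le_of_one_le h2 h3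
  nlinarith

theorem s_succ_le (p : Params) (k : ℕ) : p.s (k + 1) ≤ 4 * p.s k := by
  refine Nat.ceil_le.2 ?_
  have := p.le_s k
  push_cast
  change 40 * p.σ ^ 2 * p.d * p.L * (4 : ℝ) ^ (k + 1) ≤ _
  rw [pow_succ _ k]; linarith

theorem R_pos (p : Params) (k : ℕ) : 0 < p.R k := by unfold R; positivity

theorem τ_eq {p : Params} (k : ℕ) : p.τ k = 3 / 2 * (p.R k / √(p.M : ℝ)) := by
  unfold τ R; rw [pow_succ]; ring

theorem Valid.τ_pos {p : Params} (hp : p.Valid) (k : ℕ) : 0 < p.τ k := by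
  have := hp.sqrt_M_pos
  unfold τ; positivity

theorem Valid.τ_le_R {p : Params} (hp : p.Valid) (k : ℕ) : p.τ k ≤ 3 / 2 * p.R k := by
  rw [τ_eq]
  have := hp.one_le_sqrt_M
  have := R_pos p k
  gcongr
  exact div_le_self (by linarith) hp.one_le_sqrt_M

theorem τ_succ (p : Params) (k : ℕ) : p.τ (k + 1) = p.τ k / 2 := by
  unfold τ; rw [pow_succ _ (k + 1)]; ring

theorem Valid.B_pos {p : Params} (hp : p.Valid) (k : ℕ) : 0 < p.B k := by
  have := hp.τ_pos k
  unfold B; split_ifs <;> linarith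

theorem Valid.resolution_pos {p : Params} (hp : p.Valid) (k : ℕ) : 0 < p.α k := by
  have := hp.s_cast_pos k
  have := hp.d_cast
  have := hp.α_pos
  have := hp.σ_pos
  unfold α; positivity

/-- The deviation allowed for a sum of `s k` unit-variance noise variables. -/
noncomputable def dev (p : Params) (k : ℕ) : ℝ := √(5 / 2 * p.L * p.s k)

/-- This is what the factor 40 in `s_k` is for: the square of the left side is `(5/2) d σ² L / s_k`,
and `(5/2) / 40 = (1/4)²`. -/
theorem Valid.dev_le {p : Params} (hp : p.Valid) (k : ℕ) :
    √(p.d : ℝ) * (p.σ * p.dev k / p.s k) ≤ p.R k / 4 := by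
  have hs := hp.s_cast_pos k
  have hd := hp.d_cast
  have hl := hp.one_le_L
  have hσ := hp.σ_pos
  have hR := R_pos p k
  have h0 : 0 ≤ √(p.d : ℝ) * (p.σ * p.dev k / p.s k) := by unfold dev; positivity
  rw [← pow_le_pow_iff_left₀ h0 (by positivity) (two_ne_zero)]
  have h1 : (√(p.d : ℝ) * (p.σ * p.dev k / p.s k)) ^ 2
      = p.d * p.σ ^ 2 * (5 / 2 * p.L) / p.s k := by
    rw [mul_pow, div_pow, mul_pow, dev, Real.sq_sqrt (by linarith), Real.sq_sqrt (by positivity)]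
    field_simp
  have h2 : (p.R k) ^ 2 * 4 ^ k = 1 := by
    unfold R; rw [← pow_mul, mul_comm k 2, pow_mul, ← mul_pow]; norm_num
  rw [h1, div_le_iff₀ hs]
  have h3 := p.le_s k
  have h4 : (p.R k / 4) ^ 2 * (40 * p.σ ^ 2 * p.d * p.L * (4 : ℝ) ^ k) ≤ (p.R k / 4) ^ 2 * p.s k :=
    by gcongr
  refine le_trans (le_of_eq ?_) h4
  calc _ = 5 / 2 * (p.d * p.σ ^ 2 * p.L) * 1 := by ring
    _ = 5 / 2 * (p.d * p.σ ^ 2 * p.L) * ((p.R k) ^ 2 * 4 ^ k) := by rw [h2]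
    _ = _ := by ring

end Params

variable (p : Params) (w : World p.d p.M)

/-- The noiseless-channel message of agent `j`: its clipped estimate before quantization. -/
noncomputable def clipped (S : State p.d) (j : Fin p.M) : E p.d :=
  clip (localEstimate p w S j - S.θbar) (p.R S.k + p.B S.k)

/-- The sum of the noise over the `m`-th block of plays of basis vector `i` by agent `j`. -/
noncomputable def noiseSum (S : State p.d) (j : Fin p.M) (i : Fin p.d) : ℝ :=
  ∑ m ∈ Finset.range (p.s S.k), w.noise j (S.start + (i : ℕ) * p.s S.k + m)

/-- All deviations in phase `n` are as small as they typically are. -/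
structure GoodPhase (n : ℕ) : Prop where
  agent : ∀ j i, |noiseSum p w (state p w n) j i| ≤ p.σ * p.dev (state p w n).k
  average : ∀ i, |∑ j, noiseSum p w (state p w n) j i|
    ≤ p.σ * (p.dev (state p w n).k * √(p.M : ℝ))
  quant : ∀ i, |∑ j, (uplink p w n (state p w n) j i - clipped p w (state p w n) j i)|
    ≤ p.σ * (p.dev (state p w n).k * √(p.M : ℝ) / (2 * p.s (state p w n).k))

variable {p w}

theorem localEstimate_sub (hp : p.Valid) (S : State p.d) (j : Fin p.M) :
    localEstimate p w S j - w.θ = ∑ i, (noiseSum p w S j i / p.s S.k) • w.basis i := by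
  have hs := hp.s_cast_pos S.k
  conv_lhs => rw [← w.basis.sum_repr' w.θ]
  rw [localEstimate, ← Finset.sum_sub_distrib]
  refine Finset.sum_congr rfl fun i _ => ?_
  rw [← sub_smul]
  congr 1
  simp only [World.reward, noiseSum]
  rw [Finset.sum_add_distrib, Finset.sum_const, Finset.card_range, nsmul_eq_mul,
    real_inner_comm]
  field_simp
  ring

theorem GoodPhase.norm_localEstimate_sub {n : ℕ} (h : GoodPhase p w n) (hp : p.Valid)
    (j : Fin p.M) :
    ‖localEstimate p w (state p w n) j - w.θ‖ ≤ p.R (state p w n).k / 4 := by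
  have hs := hp.s_cast_pos (state p w n).k
  rw [localEstimate_sub hp]
  refine (norm_orthonormalBasis_sum_le _ ?_ fun i => ?_).trans (hp.dev_le _)
  · have := hp.σ_pos; unfold Params.dev; positivity
  · rw [abs_div, abs_of_pos hs]
    exact div_le_div_of_nonneg_right (h.agent j i) hs.le

/-- Averaging over `M` agents gains `√M` over the bound `R_k / 4` of a single agent, and `R_k / (4
√M) = τ_k / 6`. -/
theorem GoodPhase.norm_average_sub {n : ℕ} (h : GoodPhase p w n) (hp : p.Valid) :
    ‖(1 / (p.M : ℝ)) • ∑ j, (localEstimate p w (state p w n) j - w.θ)‖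
      ≤ p.τ (state p w n).k / 6 := by
  have hs := hp.s_cast_pos (state p w n).k
  have hM := hp.M_cast
  have hq := hp.sqrt_M_pos
  have hM0 : (0 : ℝ) < p.M := by linarith
  have e : (1 / (p.M : ℝ)) • ∑ j, (localEstimate p w (state p w n) j - w.θ)
      = ∑ i, ((∑ j, noiseSum p w (state p w n) j i) / p.s (state p w n).k / p.M) • w.basis i := by
    simp_rw [localEstimate_sub hp]
    rw [Finset.sum_comm, Finset.smul_sum]
    refine Finset.sum_congr rfl fun i _ => ?_
    rw [← Finset.sum_smul, smul_smul, Finset.sum_div]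
    congr 1
    ring
  rw [e]
  have hσ := hp.σ_pos
  refine (norm_orthonormalBasis_sum_le _ (c := p.σ * (p.dev (state p w n).k) /
    p.s (state p w n).k / √(p.M : ℝ)) ?_ fun i => ?_).trans ?_
  · unfold Params.dev; positivity
  · rw [abs_div, abs_div, abs_of_pos hs, abs_of_pos hM0]
    calc _ ≤ p.σ * (p.dev (state p w n).k * √(p.M : ℝ)) / p.s (state p w n).k / p.M := by
          gcongr; exact h.average i
      _ = p.σ * (p.dev (state p w n).k) / p.s (state p w n).k * (√(p.M : ℝ) / p.M) := by ring
      _ = _ := by rw [Real.sqrt_div_self]; ring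
  · have := hp.dev_le (state p w n).k
    rw [Params.τ_eq]
    calc _ = √(p.d : ℝ) * (p.σ * p.dev (state p w n).k / p.s (state p w n).k) / √(p.M : ℝ) := by
          ring
      _ ≤ p.R (state p w n).k / 4 / √(p.M : ℝ) := by gcongr
      _ = _ := by ring

/-- The bound `quant` allows half the deviation of the averaged noise, hence half of `τ_k / 6`. The
resolution `α_k` is matched to the noise level `σ / √s_k` per coordinate for this purpose. -/
theorem GoodPhase.norm_quant {n : ℕ} (h : GoodPhase p w n) (hp : p.Valid) :
    ‖(1 / (p.M : ℝ)) • ∑ j, (uplink p w n (state p w n) j - clipped p w (state p w n) j)‖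
      ≤ p.τ (state p w n).k / 12 := by
  have hs := hp.s_cast_pos (state p w n).k
  have hM := hp.M_cast
  have hq := hp.sqrt_M_pos
  have hM0 : (0 : ℝ) < p.M := by linarith
  have hσ := hp.σ_pos
  refine (norm_le_of_abs_le (c := p.σ * (p.dev (state p w n).k) /
    p.s (state p w n).k / √(p.M : ℝ) / 2) ?_ fun i => ?_).trans ?_
  · unfold Params.dev; positivity
  · have e : ((1 / (p.M : ℝ)) • ∑ j, (uplink p w n (state p w n) j
        - clipped p w (state p w n) j)) i = (∑ j, (uplink p w n (state p w n) j i
        - clipped p w (state p w n) j i)) / p.M := by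
      simp [div_eq_inv_mul]
    rw [e, abs_div, abs_of_pos hM0]
    calc _ ≤ p.σ * (p.dev (state p w n).k * √(p.M : ℝ) / (2 * p.s (state p w n).k)) / p.M := by
          gcongr; exact h.quant i
      _ = p.σ * (p.dev (state p w n).k) / p.s (state p w n).k * (√(p.M : ℝ) / p.M) / 2 := by
          field_simp
      _ = _ := by rw [Real.sqrt_div_self]; ring
  · have := hp.dev_le (state p w n).k
    rw [Params.τ_eq]
    calc _ = √(p.d : ℝ) * (p.σ * p.dev (state p w n).k / p.s (state p w n).k) / √(p.M : ℝ) / 2 := by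
          ring
      _ ≤ p.R (state p w n).k / 4 / √(p.M : ℝ) / 2 := by gcongr
      _ = _ := by ring

/-- The server's estimate of the residual `θ - θ̄` before downlink quantization. -/
noncomputable def serverResidual (p : Params) (w : World p.d p.M) (n : ℕ) (S : State p.d) : E p.d :=
  (1 / (p.M : ℝ)) • ∑ j : Fin p.M, uplink p w n S j

theorem serverEstimate_eq (n : ℕ) (S : State p.d) :
    serverEstimate p w n S = S.θbar + serverResidual p w n S := rfl

theorem norm_average_le (hp : p.Valid) {x : Fin p.M → E p.d} {c : ℝ} (h : ∀ j, ‖x j‖ ≤ c) :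
    ‖(1 / (p.M : ℝ)) • ∑ j, x j‖ ≤ c := by
  have hM0 : (0 : ℝ) < p.M := by linarith [hp.M_cast]
  rw [norm_smul, Real.norm_of_nonneg (by positivity), one_div, inv_mul_le_iff₀ hM0]
  calc ‖∑ j, x j‖ ≤ ∑ j, ‖x j‖ := norm_sum_le _ _
    _ ≤ ∑ _j : Fin p.M, c := Finset.sum_le_sum fun j _ => h j
    _ = p.M * c := by simp

/-- All clipped vectors lie in a ball of radius `R_k + B_k`, and so does their average. No
information on `θ` enters, so the bound survives when clipping is active. -/
theorem GoodPhase.norm_serverResidual {n : ℕ} (h : GoodPhase p w n) (hp : p.Valid) :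
    ‖serverResidual p w n (state p w n)‖
      ≤ p.R (state p w n).k + p.B (state p w n).k + p.τ (state p w n).k / 12 := by
  have hr : 0 ≤ p.R (state p w n).k + p.B (state p w n).k := by
    linarith [Params.R_pos p (state p w n).k, hp.B_pos (state p w n).k]
  have e : serverResidual p w n (state p w n) =
      (1 / (p.M : ℝ)) • ∑ j, clipped p w (state p w n) j +
      (1 / (p.M : ℝ)) • ∑ j, (uplink p w n (state p w n) j - clipped p w (state p w n) j) := by
    rw [serverResidual, Finset.sum_sub_distrib, smul_sub, add_sub_cancel]
  rw [e]
  exact (norm_add_le _ _).trans (add_le_add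
    (norm_average_le hp fun j => norm_clip_le _ hr) (h.norm_quant hp))

/-- The error splits into clipping bias, averaged noise and quantization error. The last two give
`τ_k/6 + τ_k/12 = τ_k/4`. A local residual is longer than `θ - θ̄` by at most `R_k/4`, so it exceeds
the clipping radius `R_k + B_k` by at most `‖θ - θ̄‖ - B_k - (3/4) R_k`. -/
theorem GoodPhase.norm_serverResidual_sub {n : ℕ} (h : GoodPhase p w n) (hp : p.Valid) :
    ‖serverResidual p w n (state p w n) - (w.θ - (state p w n).θbar)‖
      ≤ max (‖w.θ - (state p w n).θbar‖ - p.B (state p w n).k - 3 / 4 * p.R (state p w n).k) 0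
        + p.τ (state p w n).k / 4 := by
  have hr : 0 ≤ p.R (state p w n).k + p.B (state p w n).k := by
    linarith [Params.R_pos p (state p w n).k, hp.B_pos (state p w n).k]
  have hM0 : (p.M : ℝ) ≠ 0 := by linarith [hp.M_cast]
  set S := state p w n with hS
  have e : serverResidual p w n S - (w.θ - S.θbar) =
      (1 / (p.M : ℝ)) • ∑ j, (clipped p w S j - (localEstimate p w S j - S.θbar)) +
      (1 / (p.M : ℝ)) • ∑ j, (localEstimate p w S j - w.θ) +
      (1 / (p.M : ℝ)) • ∑ j, (uplink p w n S j - clipped p w S j) := by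
    simp only [serverResidual, Finset.sum_sub_distrib, smul_sub, Finset.sum_const,
      Finset.card_univ, Fintype.card_fin, ← Nat.cast_smul_eq_nsmul ℝ, smul_smul,
      one_div, inv_mul_cancel₀ hM0, one_smul]
    abel
  rw [e]
  refine (norm_add₃_le).trans ?_
  have h1 := h.norm_average_sub hp
  have h2 := h.norm_quant hp
  have h3 : ‖(1 / (p.M : ℝ)) • ∑ j, (clipped p w S j - (localEstimate p w S j - S.θbar))‖
      ≤ max (‖w.θ - S.θbar‖ - p.B S.k - 3 / 4 * p.R S.k) 0 := by
    refine norm_average_le hp fun j => ?_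
    rw [norm_sub_rev]
    refine (norm_sub_clip_le _ hr).trans (max_le_max ?_ le_rfl)
    have h4 : localEstimate p w S j - S.θbar
      = (localEstimate p w S j - w.θ) + (w.θ - S.θbar) := by abel
    have h5 := h.norm_localEstimate_sub hp j
    have h6 := norm_add_le (localEstimate p w S j - w.θ) (w.θ - S.θbar)
    rw [h4]
    rw [← hS] at h5
    linarith
  linarith

end


/-! ### The invariant of a run with good phases -/

section

variable {p : Params} {w : World p.d p.M}

open Classical in
theorem state_succ_of_none {n : ℕ} (h : (state p w n).k₀ = none) :
    state p w (n + 1) =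
      { k := if p.τ (state p w n).k ≤ 1 / 4 * ‖serverEstimate p w n (state p w n)‖
          then (state p w n).k else (state p w n).k + 1
        start := (state p w n).start + p.d * p.s (state p w n).k
        k₀ := if p.τ (state p w n).k ≤ 1 / 4 * ‖serverEstimate p w n (state p w n)‖
          then some (state p w n).k else none
        θbar := 0
        μ₀ := 0 } := by
  change step p w n (state p w n) = _
  simp only [step, h]

theorem state_succ_of_some {n k₀ : ℕ} (h : (state p w n).k₀ = some k₀) :
    state p w (n + 1) =
      { k := (state p w n).k + 1
        start := (state p w n).start + p.d * p.s (state p w n).k + p.t (state p w n).k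
          (if (state p w n).k = k₀ then ‖(state p w n).θbar + downlink p w n (state p w n)‖
            else (state p w n).μ₀)
        k₀ := some k₀
        θbar := (state p w n).θbar + downlink p w n (state p w n)
        μ₀ := if (state p w n).k = k₀ then ‖(state p w n).θbar + downlink p w n (state p w n)‖
            else (state p w n).μ₀ } := by
  change step p w n (state p w n) = _
  simp only [step, h]

/-- What is known about the state at the beginning of a phase of refinement with an index above
`k₀`. -/
structure Tracking (p : Params) (w : World p.d p.M) (S : State p.d) : Prop where
  two_le : 2 ≤ S.k
  error_le : ‖w.θ - S.θbar‖ ≤ 17 / 2 * p.τ S.k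
  le_μ₀ : 3 / 20 * ‖w.θ‖ ≤ S.μ₀
  μ₀_le : S.μ₀ ≤ 37 / 20 * ‖w.θ‖
  t_le : p.t (S.k - 1) S.μ₀ ≤ S.start

/-- The invariant maintained by a run in which all phases so far were good. -/
structure Invariant (p : Params) (w : World p.d p.M) (n : ℕ) (S : State p.d) : Prop where
  le_k : n ≤ S.k
  one_le : 1 ≤ S.k
  start_ge : 2 ≤ S.k → p.d * p.s (S.k - 1) ≤ S.start
  norm_stage : S.k₀ = none → n + 1 ≤ S.k ∧ S.θbar = 0 ∧ (S.k = 1 ∨ ‖w.θ‖ ≤ 17 / 2 * p.τ S.k)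
  refinement : ∀ k₀, S.k₀ = some k₀ → 15 / 4 * p.τ S.k ≤ ‖w.θ‖ ∧
    ((S.k = k₀ ∧ S.θbar = 0 ∧ (S.k = 1 ∨ ‖w.θ‖ ≤ 17 / 2 * p.τ S.k)) ∨
      (k₀ < S.k ∧ Tracking p w S))

theorem invariant_zero : Invariant p w 0 (state p w 0) where
  le_k := Nat.zero_le _
  one_le := le_rfl
  start_ge := fun h => by change 2 ≤ 1 at h; omega
  norm_stage := fun _ => ⟨le_rfl, rfl, Or.inl rfl⟩
  refinement := fun k₀ h => by change none = some k₀ at h; cases h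

/-- Error of the downlink message in terms of the residual error. -/
theorem GoodPhase.norm_sub_downlink {n : ℕ} (h : GoodPhase p w n) (hp : p.Valid)
    (hB : ‖w.θ - (state p w n).θbar‖ ≤ p.B (state p w n).k ∨
      (p.B (state p w n).k = 5 * p.τ (state p w n).k ∧
        ‖w.θ - (state p w n).θbar‖ ≤ 17 / 2 * p.τ (state p w n).k)) :
    ‖w.θ - ((state p w n).θbar + downlink p w n (state p w n))‖
      ≤ 17 / 4 * p.τ (state p w n).k ∧
    (‖w.θ - (state p w n).θbar‖ ≤ p.B (state p w n).k →
      ‖w.θ - ((state p w n).θbar + downlink p w n (state p w n))‖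
        ≤ 3 / 4 * p.τ (state p w n).k) := by
  have h1 := h.norm_serverResidual hp
  have h2 := h.norm_serverResidual_sub hp
  set S := state p w n with hS
  have hτ := hp.τ_pos S.k
  have hR := p.R_pos S.k
  have hB0 := hp.B_pos S.k
  have hτR := hp.τ_le_R S.k
  have hβ : 0 < p.β S.k := mul_pos hp.β_pos hτ
  have hβ' : p.β S.k ≤ p.τ S.k := by
    unfold Params.β; nlinarith [hp.β_lt]
  have hd : downlink p w n S
      = detQuantVec (serverResidual p w n S) (p.β S.k) (p.B S.k + p.τ S.k) := by
    rw [downlink, serverEstimate_eq, add_sub_cancel_left]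
  have e : ‖w.θ - (S.θbar + downlink p w n S)‖ = ‖downlink p w n S - (w.θ - S.θbar)‖ := by
    rw [norm_sub_rev]; congr 1; abel
  have h3 : ‖downlink p w n S - (w.θ - S.θbar)‖ ≤
      ‖serverResidual p w n S - (w.θ - S.θbar)‖
        + (max (‖serverResidual p w n S‖ - (p.B S.k + p.τ S.k)) 0 + p.β S.k / 2) := by
    have := norm_detQuantVec_sub_le hp.d_pos (serverResidual p w n S) hβ
      (show 0 < p.B S.k + p.τ S.k by linarith)
    rw [← hd] at this
    have h4 := norm_sub_le_norm_sub_add_norm_sub (downlink p w n S) (serverResidual p w n S)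
      (w.θ - S.θbar)
    linarith
  have h4 := norm_detQuantVec_sub_le_of_near hp.d_pos (serverResidual p w n S) (w.θ - S.θbar) hβ
      (show 0 < p.B S.k + p.τ S.k by linarith)
  rw [← hd] at h4
  rw [e]
  generalize ‖downlink p w n S - (w.θ - S.θbar)‖ = D at *
  generalize ‖serverResidual p w n S - (w.θ - S.θbar)‖ = e at *
  generalize ‖serverResidual p w n S‖ = N at *
  generalize ‖w.θ - S.θbar‖ = a at *
  -- Without clipping bias or overflow of the target, only `τ_k/4 + β_k/2` remains.
  have small : a ≤ p.B S.k → D ≤ 3 / 4 * p.τ S.k := by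
    intro ha
    rw [max_eq_right (by linarith)] at h2
    rw [max_eq_right (by linarith)] at h4
    linarith
  refine ⟨?_, small⟩
  rcases hB with ha | ⟨hB, ha⟩
  · linarith [small ha]
  -- Both bounds on `D` are needed. With `ρ = R_k/τ_k`, and as long as both excesses are active,
  -- `h3` gives about `(10/3 + ρ/4) τ_k` and `h4` gives `(27/4 - 3ρ/4) τ_k`. They cross near `ρ =
  -- 3.4`, at a value just below `17/4`. The remaining cases give less.
  · rcases max_cases (a - p.B S.k - 3 / 4 * p.R S.k) 0 with ⟨m1, m1'⟩ | ⟨m1, m1'⟩ <;>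
    rcases max_cases (N - (p.B S.k + p.τ S.k)) 0 with ⟨m2, m2'⟩ | ⟨m2, m2'⟩ <;>
    rcases max_cases (a - (p.B S.k + p.τ S.k)) 0 with ⟨m3, m3'⟩ | ⟨m3, m3'⟩ <;>
    rw [m1] at h2 <;> rw [m2] at h3 <;> rw [m3] at h4 <;> linarith

theorem B_one (p : Params) : p.B 1 = 1 := by simp [Params.B]

theorem B_of_two_le (p : Params) {k : ℕ} (hk : 2 ≤ k) : p.B k = 5 * p.τ k := by
  simp [Params.B, show k ≠ 1 by omega]

/-- The test compares `‖y‖` with `4 τ_k`, and without clipping bias `y` is within `τ_k/4` of `θ`.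
Hence the thresholds `15/4` and `17/4`, the latter being `17/2` in units of `τ_{k+1} = τ_k / 2`. In
epoch 1 the value `B_1 = 1 ≥ ‖θ‖` rules the bias out. -/
theorem Invariant.step_of_none {n : ℕ} (hI : Invariant p w n (state p w n))
    (h : GoodPhase p w n) (hp : p.Valid) (hθ : ‖w.θ‖ ≤ 1) (h0 : (state p w n).k₀ = none) :
    Invariant p w (n + 1) (state p w (n + 1)) := by
  have h1 := h.norm_serverResidual_sub hp
  obtain ⟨i1, i2, i3⟩ := hI.norm_stage h0
  have hsucc := state_succ_of_none h0
  have hse := serverEstimate_eq (p := p) (w := w) n (state p w n)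
  set S := state p w n with hS
  have hτ := hp.τ_pos S.k
  have hR := p.R_pos S.k
  rw [i2, zero_add] at hse
  rw [i2, sub_zero] at h1
  rw [hse] at hsucc
  set y := serverResidual p w n S
  have hk1 := hI.one_le
  have hB : S.k = 1 ∧ ‖w.θ‖ ≤ p.B S.k ∨ p.B S.k = 5 * p.τ S.k := by
    rcases Nat.lt_or_ge S.k 2 with hk | hk
    · left; have : S.k = 1 := by omega
      rw [this, B_one]; exact ⟨rfl, hθ⟩
    · exact Or.inr (B_of_two_le p hk)
  have t1 := norm_sub_norm_le w.θ y
  have t2 := norm_sub_norm_le y w.θ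
  rw [norm_sub_rev] at t1
  by_cases ht : p.τ S.k ≤ 1 / 4 * ‖y‖
  · rw [if_pos ht, if_pos ht] at hsucc
    rw [hsucc]
    refine ⟨i1, hk1, fun h2 => ?_, fun h2 => ?_, fun k₀ hk₀ => ?_⟩
    · exact (hI.start_ge h2).trans (Nat.le_add_right _ _)
    · cases h2
    · refine ⟨?_, Or.inl ⟨?_, rfl, i3⟩⟩
      · change 15 / 4 * p.τ S.k ≤ ‖w.θ‖
        -- If clipping is biased, then `‖θ‖ > B_k = 5 τ_k`, which is more than enough.
        rcases max_cases (‖w.θ‖ - p.B S.k - 3 / 4 * p.R S.k) 0 with ⟨m1, m1'⟩ | ⟨m1, m1'⟩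
        · rcases hB with ⟨_, hB⟩ | hB <;> linarith
        · rw [m1] at h1; linarith
      · simpa using hk₀
  · rw [if_neg ht, if_neg ht] at hsucc
    rw [hsucc]
    refine ⟨by change n + 1 ≤ S.k + 1; omega, by change 1 ≤ S.k + 1; omega, fun _ => ?_,
      fun _ => ⟨by change n + 1 + 1 ≤ S.k + 1; omega, rfl, Or.inr ?_⟩, fun k₀ hk₀ => ?_⟩
    · change p.d * p.s (S.k + 1 - 1) ≤ S.start + p.d * p.s S.k
      rw [Nat.add_sub_cancel]; omega
    · change ‖w.θ‖ ≤ 17 / 2 * p.τ (S.k + 1)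
      rw [Params.τ_succ]
      push Not at ht
      -- Biased clipping would force `‖y‖ ≥ 5 τ_k + (3/4) R_k - τ_k/4 > 4 τ_k`, against the failure
      -- of the test.
      rcases max_cases (‖w.θ‖ - p.B S.k - 3 / 4 * p.R S.k) 0 with ⟨m1, m1'⟩ | ⟨m1, m1'⟩
      · rcases hB with ⟨_, hB⟩ | hB
        · linarith
        · rw [m1] at h1; linarith
      · rw [m1] at h1; linarith
    · cases hk₀

/-- The error `(17/4) τ_k` left by the downlink message equals `(17/2) τ_{k+1}`, so the bound
reproduces itself although it exceeds `B_k = 5 τ_k`. The lower bound on `‖θ‖` persists because `τ`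
decreases. -/
theorem Invariant.step_of_some {n k₀ : ℕ} (hI : Invariant p w n (state p w n))
    (h : GoodPhase p w n) (hp : p.Valid) (hθ : ‖w.θ‖ ≤ 1) (h0 : (state p w n).k₀ = some k₀) :
    Invariant p w (n + 1) (state p w (n + 1)) ∧ Tracking p w (state p w (n + 1)) := by
  obtain ⟨i1, i2⟩ := hI.refinement k₀ h0
  have hsucc := state_succ_of_some h0
  have h1 := h.norm_sub_downlink hp
  set S := state p w n with hS
  have hk1 := hI.one_le
  have hτ := hp.τ_pos S.k
  have hB : ‖w.θ - S.θbar‖ ≤ p.B S.k ∨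
      (p.B S.k = 5 * p.τ S.k ∧ ‖w.θ - S.θbar‖ ≤ 17 / 2 * p.τ S.k) := by
    rcases Nat.lt_or_ge S.k 2 with hk | hk
    · left
      have : S.k = 1 := by omega
      rcases i2 with ⟨-, i3, -⟩ | ⟨-, i3⟩
      · rw [this, B_one, i3, sub_zero]; exact hθ
      · have := i3.two_le; omega
    · refine Or.inr ⟨B_of_two_le p hk, ?_⟩
      rcases i2 with ⟨-, i3, i4⟩ | ⟨-, i3⟩
      · rw [i3, sub_zero]
        rcases i4 with i4 | i4
        · omega
        · exact i4
      · exact i3.error_le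
  obtain ⟨h2, h3⟩ := h1 hB
  set θ' := S.θbar + downlink p w n S with hθ'
  set μ : ℝ := if S.k = k₀ then ‖θ'‖ else S.μ₀ with hμ
  have hμb : 3 / 20 * ‖w.θ‖ ≤ μ ∧ μ ≤ 37 / 20 * ‖w.θ‖ := by
    rcases i2 with ⟨i2, i3, -⟩ | ⟨i2, i3⟩
    · rw [hμ, if_pos i2]
      have t1 := norm_sub_norm_le w.θ θ'
      have t2 := norm_sub_norm_le θ' w.θ
      rw [norm_sub_rev] at t2
      -- If `‖θ‖ ≤ B_k`, the error is at most `(3/4) τ_k ≤ ‖θ‖/5`. Otherwise `‖θ‖ > 5 τ_k`, and the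
      -- error `(17/4) τ_k` is below `(17/20) ‖θ‖`. This yields the factors `3/20` and `37/20` for
      -- `μ₀`.
      have : ‖w.θ - θ'‖ ≤ 17 / 20 * ‖w.θ‖ := by
        rcases le_or_gt ‖w.θ - S.θbar‖ (p.B S.k) with hb | hb
        · linarith [h3 hb]
        · rw [i3, sub_zero] at hb hB
          rcases hB with hB | ⟨hB, -⟩ <;> linarith
      constructor <;> linarith
    · rw [hμ, if_neg (by omega)]
      exact ⟨i3.le_μ₀, i3.μ₀_le⟩
  have hT : Tracking p w (state p w (n + 1)) := by
    rw [hsucc]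
    refine ⟨by change 2 ≤ S.k + 1; omega, ?_, hμb.1, hμb.2, ?_⟩
    · change ‖w.θ - θ'‖ ≤ 17 / 2 * p.τ (S.k + 1)
      rw [Params.τ_succ]; linarith
    · change p.t (S.k + 1 - 1) μ ≤ S.start + p.d * p.s S.k + p.t S.k μ
      rw [Nat.add_sub_cancel]; omega
  refine ⟨?_, hT⟩
  have hle := hI.le_k
  refine ⟨?_, ?_, fun _ => ?_, fun h2 => ?_, fun k₁ hk₁ => ⟨?_, Or.inr ⟨?_, hT⟩⟩⟩
  · rw [hsucc]; change n + 1 ≤ S.k + 1; omega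
  · rw [hsucc]; change 1 ≤ S.k + 1; omega
  · rw [hsucc]; change p.d * p.s (S.k + 1 - 1) ≤ S.start + p.d * p.s S.k + p.t S.k μ
    rw [Nat.add_sub_cancel]; omega
  · rw [hsucc] at h2; cases h2
  · rw [hsucc]; change 15 / 4 * p.τ (S.k + 1) ≤ ‖w.θ‖
    rw [Params.τ_succ]; linarith
  · rw [hsucc] at hk₁ ⊢
    have : k₀ = k₁ := by simpa using hk₁
    change k₁ < S.k + 1
    rcases i2 with ⟨i2, -, -⟩ | ⟨i2, -⟩ <;> omega

theorem invariant_of_good (hp : p.Valid) (hθ : ‖w.θ‖ ≤ 1) {N : ℕ}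
    (h : ∀ n < N, GoodPhase p w n) : ∀ n ≤ N, Invariant p w n (state p w n) := by
  intro n
  induction n with
  | zero => exact fun _ => invariant_zero
  | succ n ih =>
    intro hn
    have hI := ih (by omega)
    rcases h0 : (state p w n).k₀ with _ | k₀
    · exact hI.step_of_none (h n (by omega)) hp hθ h0
    · exact (hI.step_of_some (h n (by omega)) hp hθ h0).1

end


section

variable {p : Params} {w : World p.d p.M}

/-! ### Phases and time -/

theorem start_add_le (n : ℕ) :
    (state p w n).start + p.d * p.s (state p w n).k ≤ (state p w (n + 1)).start := by
  rcases h : (state p w n).k₀ with _ | k₀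
  · rw [state_succ_of_none h]
  · rw [state_succ_of_some h]; exact Nat.le_add_right _ _

theorem start_strictMono (hp : p.Valid) : StrictMono fun n => (state p w n).start := by
  refine strictMono_nat_of_lt_succ fun n => ?_
  have h1 := start_add_le (p := p) (w := w) n
  have h2 : 0 < p.d * p.s (state p w n).k := Nat.mul_pos hp.d_pos (hp.s_pos _)
  omega

theorem start_phase_le (t : ℕ) : (state p w (phase p w t)).start ≤ t :=
  Nat.findGreatest_spec (P := fun n => (state p w n).start ≤ t) (Nat.zero_le t) (Nat.zero_le t)

theorem lt_start_phase_succ (hp : p.Valid) (t : ℕ) :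
    t < (state p w (phase p w t + 1)).start := by
  by_contra! h
  -- Starts are strictly increasing naturals, so phase `n` starts no earlier than time `n`.
  -- Searching for the phase only up to `t` therefore loses nothing.
  have h1 : phase p w t + 1 ≤ t := ((start_strictMono hp).le_apply).trans h
  have h2 : phase p w t + 1 ≤ phase p w t :=
    Nat.le_findGreatest (P := fun n => (state p w n).start ≤ t) h1 h
  omega

/-! ### Regret -/

/-- The regret of one agent at time `t`. -/
noncomputable def gap (p : Params) (w : World p.d p.M) (t : ℕ) : ℝ :=
  let S := state p w (phase p w t)
  ‖w.θ‖ - inner ℝ w.θ (open Classical in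
    if h : (t - S.start) / p.s S.k < p.d then w.basis ⟨(t - S.start) / p.s S.k, h⟩
    else ‖(state p w (phase p w t + 1)).θbar‖⁻¹ • (state p w (phase p w t + 1)).θbar)

theorem regret_le : regret p w ≤ p.M * ∑ t ∈ Finset.range p.T, gap p w t := by
  have key : ∀ (j : Fin p.M) t, sSup ((fun a : E p.d => inner ℝ w.θ a) '' Metric.closedBall 0 1)
      - inner ℝ w.θ (action p w j t) ≤ gap p w t := by
    intro j t
    refine sub_le_sub_right (csSup_le (Set.Nonempty.image _ ⟨0, by simp⟩) ?_) _
    rintro _ ⟨a, ha, rfl⟩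
    rw [mem_closedBall_zero_iff] at ha
    calc inner ℝ w.θ a ≤ ‖w.θ‖ * ‖a‖ := real_inner_le_norm _ _
      _ ≤ ‖w.θ‖ * 1 := by gcongr
      _ = ‖w.θ‖ := mul_one _
  calc regret p w ≤ ∑ _j : Fin p.M, ∑ t ∈ Finset.range p.T, gap p w t :=
        Finset.sum_le_sum fun j _ => Finset.sum_le_sum fun t _ => key j t
    _ = _ := by simp

theorem gap_le (t : ℕ) : gap p w t ≤ 2 * ‖w.θ‖ := by
  have key : ∀ a : E p.d, ‖a‖ ≤ 1 → ‖w.θ‖ - inner ℝ w.θ a ≤ 2 * ‖w.θ‖ := by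
    intro a ha
    have h1 := neg_le_of_abs_le (abs_real_inner_le_norm w.θ a)
    have h2 : ‖w.θ‖ * ‖a‖ ≤ ‖w.θ‖ * 1 := by gcongr
    linarith
  refine key _ ?_
  split_ifs
  · simp
  · rw [norm_smul, norm_inv, norm_norm]
    exact inv_mul_le_one

/-- The constant `40 σ² + 1` governing the length of exploration. -/
noncomputable def Params.Γ (p : Params) : ℝ := 40 * p.σ ^ 2 + 1

theorem Params.one_le_Γ (p : Params) : 1 ≤ p.Γ := by unfold Params.Γ; nlinarith [sq_nonneg p.σ]

theorem Params.Valid.one_le_dL (hp : p.Valid) : 1 ≤ p.d * p.L :=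
  one_le_mul_of_one_le_of_one_le hp.d_cast hp.one_le_L

theorem Params.R_mul_two_pow (p : Params) (k : ℕ) : p.R k * 2 ^ k = 1 := by
  unfold Params.R; rw [← mul_pow]; norm_num

theorem Params.R_le_one (p : Params) (k : ℕ) : p.R k ≤ 1 :=
  pow_le_one₀ (by norm_num) (by norm_num)

theorem t_bound {M s μ T : ℝ} {t : ℕ} (hM : 0 ≤ M)
    (h : M * s ^ 2 * μ ^ 2 ≤ t) (ht : t ≤ T) : √M * (s * μ) ≤ √T := by
  refine Real.le_sqrt_of_sq_le ?_
  rw [mul_pow, Real.sq_sqrt hM]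
  nlinarith

/-- Regret of exploration in one phase. -/
theorem explore_regret_le (hp : p.Valid) {n : ℕ} {S : State p.d} (hI : Invariant p w n S)
    (hT : p.M * p.d ^ 2 ≤ p.T) (hθ : ‖w.θ‖ ≤ 1)
    (hS : S.start ≤ p.T) {c : ℕ} (hc : c ≤ p.d * p.s S.k) (hcT : c ≤ p.T) :
    p.M * (c * (2 * ‖w.θ‖)) ≤ 54 * p.Γ * (p.d * p.L * (√(p.M : ℝ) * √(p.T : ℝ))) := by
  have hM := hp.M_cast
  have hd := hp.d_cast
  have hL := hp.one_le_L
  have hΓ := p.one_le_Γ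
  have hdL := hp.one_le_dL
  have hq := hp.sqrt_M_pos
  have hτ := hp.τ_pos S.k
  have hR := p.R_pos S.k
  have hc' : (c : ℝ) ≤ p.d * p.s S.k := by exact_mod_cast hc
  have hcT' : (c : ℝ) ≤ p.T := by exact_mod_cast hcT
  have hMM : (p.M : ℝ) = √(p.M : ℝ) * √(p.M : ℝ) := by
    rw [Real.mul_self_sqrt (by linarith)]
  have hs := hp.s_le S.k
  have hs0 := hp.s_cast_pos S.k
  set X := p.d * p.L * (√(p.M : ℝ) * √(p.T : ℝ)) with hX
  have hX0 : 0 ≤ X := by positivity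
  have hdT : √(p.M : ℝ) * p.d ≤ √(p.T : ℝ) := by
    refine Real.le_sqrt_of_sq_le ?_
    rw [mul_pow, Real.sq_sqrt (by linarith)]
    exact_mod_cast hT
  -- In epoch 1 the cost is of order `M d² L`, and `√M d ≤ √T` trades one factor `√M d` for `√T`.
  have first : S.k = 1 → p.M * (c * (2 * ‖w.θ‖)) ≤ 54 * p.Γ * X := by
    intro hk
    rw [hk] at hs hc'
    calc p.M * (c * (2 * ‖w.θ‖))
        ≤ p.M * ((p.d * (4 ^ 1 * (p.d * p.L * p.Γ))) * (2 * 1)) := by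
          gcongr; exact hc'.trans (by gcongr; exact hs)
      _ = 8 * p.Γ * (p.d * p.L * (√(p.M : ℝ) * (√(p.M : ℝ) * p.d))) := by
          conv_lhs => rw [hMM]
          ring
      _ ≤ 8 * p.Γ * (p.d * p.L * (√(p.M : ℝ) * √(p.T : ℝ))) := by gcongr
      _ ≤ 54 * p.Γ * X := by rw [← hX]; gcongr; norm_num
  have small : ‖w.θ‖ ≤ 17 / 2 * p.τ S.k → p.M * (c * (2 * ‖w.θ‖)) ≤ 54 * p.Γ * X := by
    intro hθ'
    -- `c` is at most both `d s_k` and `T`, hence at most their geometric mean. The growth `2^k` is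
    -- then cancelled by `τ_k`.
    have hc2 : (c : ℝ) ≤ 2 ^ S.k * (p.d * p.L * p.Γ) * √(p.T : ℝ) := by
      refine abs_le_of_sq_le_sq' ?_ (by positivity) |>.2
      rw [mul_pow, Real.sq_sqrt (by positivity), mul_pow, ← pow_mul, mul_comm S.k 2, pow_mul,
        sq (c : ℝ)]
      have : (c : ℝ) ≤ (2 ^ 2) ^ S.k * (p.d * p.L * p.Γ) ^ 2 := by
        refine hc'.trans ?_
        calc p.d * p.s S.k ≤ p.d * (4 ^ S.k * (p.d * p.L * p.Γ)) := by gcongr; exact hs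
          _ = 4 ^ S.k * (p.d * 1 * 1) * (p.d * p.L * p.Γ) := by ring
          _ ≤ 4 ^ S.k * (p.d * p.L * p.Γ) * (p.d * p.L * p.Γ) := by gcongr
          _ = _ := by norm_num; ring
      gcongr
    calc p.M * (c * (2 * ‖w.θ‖))
        ≤ p.M * ((2 ^ S.k * (p.d * p.L * p.Γ) * √(p.T : ℝ)) * (2 * (17 / 2 * p.τ S.k))) := by
          gcongr
      _ = p.M * ((2 ^ S.k * (p.d * p.L * p.Γ) * √(p.T : ℝ)) *
            (51 / 2 * (p.R S.k / √(p.M : ℝ)))) := by rw [p.τ_eq]; ring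
      _ = 51 / 2 * p.Γ * X * (p.R S.k * 2 ^ S.k) := by
          rw [hX]
          linear_combination (51 / 2 * 2 ^ S.k * (p.d * p.L * p.Γ) * √(p.T : ℝ) * p.R S.k) *
            Real.div_sqrt (x := (p.M : ℝ))
      _ ≤ 54 * p.Γ * X := by rw [p.R_mul_two_pow, mul_one]; gcongr; norm_num
  -- The exploitation of the preceding epoch ended by `S.start ≤ T`, so `√M s_{k-1} μ₀ ≤ √T`. Since
  -- `s_k ≤ 4 s_{k-1}` and `‖θ‖ ≤ (20/3) μ₀`, this bounds the cost of the present exploration.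
  have tracked : Tracking p w S → p.M * (c * (2 * ‖w.θ‖)) ≤ 54 * p.Γ * X := by
    intro hT
    have h2 := hT.two_le
    have hsk : (p.s S.k : ℝ) ≤ 4 * p.s (S.k - 1) := by
      have := p.s_succ_le (S.k - 1)
      rw [Nat.sub_add_cancel (by omega)] at this
      exact_mod_cast this
    have hμ := hT.le_μ₀
    have hμ0 : 0 ≤ S.μ₀ := by linarith [norm_nonneg w.θ]
    have h3 : √(p.M : ℝ) * (p.s (S.k - 1) * S.μ₀) ≤ √(p.T : ℝ) :=
      t_bound (t := p.t (S.k - 1) S.μ₀) (by linarith)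
        (Nat.le_ceil _) (by exact_mod_cast hT.t_le.trans hS)
    calc p.M * (c * (2 * ‖w.θ‖))
        ≤ p.M * ((p.d * (4 * p.s (S.k - 1))) * (2 * (20 / 3 * S.μ₀))) := by
          gcongr
          · exact hc'.trans (by gcongr)
          · linarith
      _ = 160 / 3 * (p.d * 1 * (√(p.M : ℝ) * (√(p.M : ℝ) * (p.s (S.k - 1) * S.μ₀)))) := by
          conv_lhs => rw [hMM]
          ring
      _ ≤ 54 * p.Γ * X := by
          rw [hX]
          gcongr
          linarith
  rcases h0 : S.k₀ with _ | k₀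
  · rcases (hI.norm_stage h0).2.2 with h | h
    exacts [first h, small h]
  · rcases (hI.refinement k₀ h0).2 with ⟨-, -, h | h⟩ | ⟨-, h⟩
    exacts [first h, small h, tracked h]

/-- Regret of exploitation in one phase. -/
theorem exploit_regret_le (hp : p.Valid) {k : ℕ} {g e μ : ℝ} {c : ℕ}
    (hθ : 15 / 4 * p.τ k ≤ ‖w.θ‖) (he : e ≤ 17 / 4 * p.τ k) (he0 : 0 ≤ e)
    (hg : ‖w.θ‖ * g ≤ 2 * e ^ 2) (hμ0 : 0 ≤ μ) (hμ : μ ≤ 37 / 20 * ‖w.θ‖)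
    (hc : c ≤ p.t k μ) (hcT : c ≤ p.T) :
    p.M * (c * g) ≤ 246 * p.Γ * (p.d * p.L * (√(p.M : ℝ) * √(p.T : ℝ))) := by
  have hM := hp.M_cast
  have hd := hp.d_cast
  have hL := hp.one_le_L
  have hΓ := p.one_le_Γ
  have hdL := hp.one_le_dL
  have hq := hp.sqrt_M_pos
  have hτ := hp.τ_pos k
  have hR := p.R_pos k
  have hs := hp.s_le k
  have hs0 := hp.s_cast_pos k
  have hM0 : (0 : ℝ) < p.M := by linarith
  have hθ0 : 0 < ‖w.θ‖ := by linarith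
  have hτ2 : p.M * p.τ k ^ 2 = 9 / 4 * p.R k ^ 2 := by
    rw [p.τ_eq, mul_pow, div_pow (p.R k), Real.sq_sqrt hM0.le]; field_simp; norm_num
  have hMg : p.M * (‖w.θ‖ * g) ≤ 82 * p.R k ^ 2 := by
    calc p.M * (‖w.θ‖ * g) ≤ p.M * (2 * (17 / 4 * p.τ k) ^ 2) := by
          refine mul_le_mul_of_nonneg_left (hg.trans ?_) hM0.le
          gcongr
      _ = 289 / 8 * (p.M * p.τ k ^ 2) := by ring
      _ ≤ 82 * p.R k ^ 2 := by rw [hτ2]; nlinarith [sq_nonneg (p.R k)]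
  -- Again the geometric mean of two bounds, `t_k` and `T`. The `+ 1` comes from the ceiling in
  -- `t_k`.
  have hcb : (c : ℝ) ≤ (√(p.M : ℝ) * (p.s k * μ) + 1) * √(p.T : ℝ) := by
    have h1 : (c : ℝ) ≤ p.M * p.s k ^ 2 * μ ^ 2 + 1 := by
      have h2 : (p.t k μ : ℝ) < p.M * p.s k ^ 2 * μ ^ 2 + 1 := Nat.ceil_lt_add_one (by positivity)
      have h3 : (c : ℝ) ≤ p.t k μ := by exact_mod_cast hc
      linarith
    refine abs_le_of_sq_le_sq' ?_ (by positivity) |>.2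
    rw [mul_pow, Real.sq_sqrt (by positivity), sq (c : ℝ)]
    have h4 : (c : ℝ) ≤ (√(p.M : ℝ) * (p.s k * μ) + 1) ^ 2 := by
      have h5 : (√(p.M : ℝ) * (p.s k * μ)) ^ 2 = p.M * p.s k ^ 2 * μ ^ 2 := by
        rw [mul_pow, Real.sq_sqrt hM0.le]; ring
      have h6 : 0 ≤ √(p.M : ℝ) * (p.s k * μ) := by positivity
      nlinarith
    have h7 : (c : ℝ) ≤ p.T := by exact_mod_cast hcT
    gcongr
  have hRs : p.R k ^ 2 * p.s k ≤ p.d * p.L * p.Γ := by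
    calc p.R k ^ 2 * p.s k ≤ p.R k ^ 2 * (4 ^ k * (p.d * p.L * p.Γ)) := by gcongr; exact hs
      _ = (p.R k * 2 ^ k) ^ 2 * (p.d * p.L * p.Γ) := by
          rw [mul_pow, ← pow_mul, mul_comm k 2, pow_mul]; norm_num; ring
      _ = _ := by rw [p.R_mul_two_pow]; ring
  -- This absorbs the term coming from the ceiling.
  have hRθ : p.R k ^ 2 ≤ √(p.M : ℝ) * ‖w.θ‖ := by
    calc p.R k ^ 2 ≤ p.R k := by nlinarith [p.R_le_one k]
      _ ≤ √(p.M : ℝ) * (15 / 4 * p.τ k) := by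
          rw [p.τ_eq]; field_simp; linarith
      _ ≤ _ := by gcongr
  -- The gap is of order `τ_k²/‖θ‖` and the length of order `√(MT) s_k ‖θ‖`, so `‖θ‖` cancels. The
  -- remaining `R_k² s_k` is `O(d L)`.
  have main : ‖w.θ‖ * (p.M * (c * g)) ≤
      ‖w.θ‖ * (246 * p.Γ * (p.d * p.L * (√(p.M : ℝ) * √(p.T : ℝ)))) := by
    calc ‖w.θ‖ * (p.M * (c * g)) = c * (p.M * (‖w.θ‖ * g)) := by ring
      _ ≤ c * (82 * p.R k ^ 2) := by gcongr
      _ ≤ ((√(p.M : ℝ) * (p.s k * (37 / 20 * ‖w.θ‖)) + 1) * √(p.T : ℝ)) * (82 * p.R k ^ 2) := by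
          gcongr; exact hcb.trans (by gcongr)
      _ = 82 * √(p.T : ℝ) * (37 / 20 * √(p.M : ℝ) * ‖w.θ‖ * (p.R k ^ 2 * p.s k) + p.R k ^ 2) := by
          ring
      _ ≤ 82 * √(p.T : ℝ) * (37 / 20 * √(p.M : ℝ) * ‖w.θ‖ * (p.d * p.L * p.Γ)
            + √(p.M : ℝ) * ‖w.θ‖ * (p.d * p.L * p.Γ)) := by
          gcongr
          refine hRθ.trans (le_mul_of_one_le_right (by positivity) ?_)
          exact one_le_mul_of_one_le_of_one_le hdL hΓ
      _ = (82 * 57 / 20) * (‖w.θ‖ * (p.Γ * (p.d * p.L * (√(p.M : ℝ) * √(p.T : ℝ))))) := by ring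
      _ ≤ 246 * (‖w.θ‖ * (p.Γ * (p.d * p.L * (√(p.M : ℝ) * √(p.T : ℝ))))) := by
          gcongr; norm_num
      _ = _ := by ring
  exact le_of_mul_le_mul_left main hθ0

/-- Regret of one phase. -/
theorem phase_regret_le (hp : p.Valid) (hT : p.M * p.d ^ 2 ≤ p.T) (hθ : ‖w.θ‖ ≤ 1) {n : ℕ}
    (hI : Invariant p w n (state p w n)) (hG : GoodPhase p w n) :
    p.M * ∑ t ∈ Finset.range p.T with phase p w t = n, gap p w t
      ≤ 300 * p.Γ * (p.d * p.L * (√(p.M : ℝ) * √(p.T : ℝ))) := by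
  have hX0 : 0 ≤ p.d * p.L * (√(p.M : ℝ) * √(p.T : ℝ)) := by
    have := hp.one_le_dL; positivity
  have hΓ := p.one_le_Γ
  have hM := hp.M_cast
  set S := state p w n with hS
  have hs := hp.s_pos S.k
  rcases le_or_gt S.start p.T with hst | hst
  swap
  · rw [Finset.filter_eq_empty_iff.2, Finset.sum_empty, mul_zero]
    · positivity
    · rintro t ht rfl
      have h : S.start ≤ t := start_phase_le t
      rw [Finset.mem_range] at ht
      omega
  rw [← Finset.sum_filter_add_sum_filter_not _ (fun t => (t - S.start) / p.s S.k < p.d), mul_add]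
  set F := Finset.filter (fun t => phase p w t = n) (Finset.range p.T) with hF
  have hFT : F.card ≤ p.T := (Finset.card_filter_le _ _).trans (by simp)
  have hmem : ∀ t ∈ F, S.start ≤ t ∧ t < (state p w (n + 1)).start := by
    intro t ht
    obtain ⟨-, rfl⟩ := Finset.mem_filter.1 ht
    exact ⟨start_phase_le t, lt_start_phase_succ hp t⟩
  have hdiv : ∀ t, (t - S.start) / p.s S.k < p.d ↔ t - S.start < p.d * p.s S.k := fun t =>
    Nat.div_lt_iff_lt_mul hs
  have h1 : p.M * ∑ t ∈ F with (t - S.start) / p.s S.k < p.d, gap p w t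
      ≤ 54 * p.Γ * (p.d * p.L * (√(p.M : ℝ) * √(p.T : ℝ))) := by
    refine le_trans ?_ (explore_regret_le hp hI hT hθ hst
      (c := (F.filter fun t => (t - S.start) / p.s S.k < p.d).card) ?_ ?_)
    · gcongr
      rw [← nsmul_eq_mul]
      exact Finset.sum_le_card_nsmul _ _ _ fun t _ => gap_le t
    · have : (F.filter fun t => (t - S.start) / p.s S.k < p.d)
          ⊆ Finset.Ico S.start (S.start + p.d * p.s S.k) := by
        intro t ht
        obtain ⟨ht1, ht2⟩ := Finset.mem_filter.1 ht
        have := hmem t ht1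
        rw [hdiv] at ht2
        rw [Finset.mem_Ico]; omega
      refine (Finset.card_le_card this).trans ?_
      simp
    · exact (Finset.card_filter_le _ _).trans hFT
  have h2 : p.M * ∑ t ∈ F with ¬ (t - S.start) / p.s S.k < p.d, gap p w t
      ≤ 246 * p.Γ * (p.d * p.L * (√(p.M : ℝ) * √(p.T : ℝ))) := by
    have hsub : (F.filter fun t => ¬ (t - S.start) / p.s S.k < p.d)
        ⊆ Finset.Ico (S.start + p.d * p.s S.k) (state p w (n + 1)).start := by
      intro t ht
      obtain ⟨ht1, ht2⟩ := Finset.mem_filter.1 ht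
      have := hmem t ht1
      rw [hdiv] at ht2
      rw [Finset.mem_Ico]; omega
    have hcard := Finset.card_le_card hsub
    rw [Nat.card_Ico] at hcard
    rcases h0 : S.k₀ with _ | k₀
    · have e := state_succ_of_none h0
      rw [e] at hcard
      simp only [← hS, Nat.sub_self, Nat.le_zero, Finset.card_eq_zero] at hcard
      rw [hcard, Finset.sum_empty, mul_zero]
      positivity
    · obtain ⟨-, hTr⟩ := hI.step_of_some hG hp hθ h0
      have hk : (state p w (n + 1)).k = S.k + 1 := by rw [state_succ_of_some h0]
      have hcard' : (F.filter fun t => ¬ (t - S.start) / p.s S.k < p.d).card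
          ≤ p.t S.k (state p w (n + 1)).μ₀ := by
        refine hcard.trans ?_
        rw [state_succ_of_some h0]
        simp only [← hS]
        omega
      have herr := hTr.error_le
      rw [hk, Params.τ_succ] at herr
      have hμ := hTr.le_μ₀
      refine le_trans ?_ (exploit_regret_le hp (g := ‖w.θ‖ - inner ℝ w.θ
        (‖(state p w (n + 1)).θbar‖⁻¹ • (state p w (n + 1)).θbar))
        (hI.refinement k₀ h0).1 (e := ‖w.θ - (state p w (n + 1)).θbar‖) (by linarith)
        (norm_nonneg _) (norm_mul_gap_le _ _) (by linarith [norm_nonneg w.θ]) hTr.μ₀_le hcard'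
        ((Finset.card_filter_le _ _).trans hFT))
      gcongr
      rw [← nsmul_eq_mul]
      refine Finset.sum_le_card_nsmul _ _ _ fun t ht => le_of_eq ?_
      obtain ⟨ht1, ht2⟩ := Finset.mem_filter.1 ht
      obtain ⟨-, rfl⟩ := Finset.mem_filter.1 ht1
      simp only [gap]
      rw [dif_neg ht2]
  linarith

/-- The definition of `K` gives `4^K ≤ T / (40 σ²) + 4`. Requiring `T` to exceed `4 + 1/(40 σ²)`
turns this into `4^K ≤ T²`, which removes `σ` from the constant. -/
theorem Params.Valid.K_le_log (hp : p.Valid) (hT : 4 + 1 / (40 * p.σ ^ 2) ≤ p.T) :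
    (p.K : ℝ) ≤ 4 * Real.log (9 * √((p.M : ℝ) * p.T)) := by
  have hσ := hp.σ_pos
  have hM := hp.M_cast
  have hdL := hp.one_le_dL
  have hT0 : 0 < 1 / (40 * p.σ ^ 2) := by positivity
  have hT4 : (4 : ℝ) ≤ p.T := by linarith
  have h4 : (4 : ℝ) ^ 1 ≤ 4 ^ p.K := pow_le_pow_right₀ (by norm_num) hp.one_le_K
  have h1 : 40 * p.σ ^ 2 * ((4 : ℝ) ^ p.K - 4) ≤ p.T := by
    refine le_trans ?_ hp.K_spec
    have : 0 ≤ (4 : ℝ) ^ p.K - 4 := by linarith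
    calc 40 * p.σ ^ 2 * ((4 : ℝ) ^ p.K - 4) = 40 * p.σ ^ 2 * 1 * ((4 : ℝ) ^ p.K - 4) := by ring
      _ ≤ 40 * p.σ ^ 2 * (p.d * p.L) * ((4 : ℝ) ^ p.K - 4) := by gcongr
      _ = _ := by ring
  have h2 : (4 : ℝ) ^ p.K ≤ p.T ^ 2 := by
    have : (4 : ℝ) ^ p.K - 4 ≤ p.T * (1 / (40 * p.σ ^ 2)) := by
      rw [mul_one_div, le_div_iff₀ (by positivity)]; linarith
    nlinarith
  have h3 : (p.K : ℝ) * Real.log 4 ≤ 2 * Real.log p.T := by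
    rw [← Real.log_pow]
    have := Real.log_le_log (by positivity) h2
    rwa [Real.log_pow (n := 2)] at this
  have h5 : (1 : ℝ) ≤ Real.log 4 := by
    rw [Real.le_log_iff_exp_le (by norm_num)]; linarith [Real.exp_one_lt_d9]
  have h6 : Real.log p.T ≤ 2 * Real.log (9 * √((p.M : ℝ) * p.T)) := by
    have e : Real.log p.T = 2 * Real.log √(p.T : ℝ) := by
      rw [Real.log_sqrt (by positivity)]; ring
    rw [e]
    have : √(p.T : ℝ) ≤ 9 * √((p.M : ℝ) * p.T) := by
      have : √(p.T : ℝ) ≤ √((p.M : ℝ) * p.T) :=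
        Real.sqrt_le_sqrt (le_mul_of_one_le_left (by positivity) hM)
      linarith [Real.sqrt_nonneg (p.T : ℝ)]
    have := Real.log_le_log (Real.sqrt_pos.2 (by linarith)) this
    linarith
  have h7 : (p.K : ℝ) * 1 ≤ p.K * Real.log 4 := by gcongr
  linarith

/-- The regret bound on the event that the first `K + 3` phases are good. -/
theorem regret_le_of_good (hp : p.Valid) (hT : p.M * p.d ^ 2 ≤ p.T)
    (hT' : 4 + 1 / (40 * p.σ ^ 2) ≤ p.T) (hθ : ‖w.θ‖ ≤ 1)
    (hG : ∀ n < p.K + 3, GoodPhase p w n) :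
    regret p w ≤ 4800 * (40 * p.σ ^ 2 + 1) * p.d * √((p.M : ℝ) * p.T) * p.L
      * Real.log (9 * √((p.M : ℝ) * p.T)) := by
  have hI := invariant_of_good hp hθ hG
  have hX0 : 0 ≤ p.d * p.L * (√(p.M : ℝ) * √(p.T : ℝ)) := by
    have := hp.one_le_dL; positivity
  have hK1 := hp.one_le_K
  -- The epoch index stalls only in the phase that ends norm estimation, so it is at least `K + 3`
  -- when phase `K + 3` begins. The exploration of an index at least `K + 2` is then complete, and
  -- it alone is longer than `T`. The spare factor 4 covers the factor 2 lost in `Valid.lt_of_K`.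
  have hmaps : ∀ t ∈ Finset.range p.T, phase p w t ∈ Finset.range (p.K + 3) := by
    intro t ht
    rw [Finset.mem_range] at ht ⊢
    by_contra! h
    have h1 := hI (p.K + 3) le_rfl
    have h2 : (state p w (p.K + 3)).start ≤ (state p w (phase p w t)).start :=
      (start_strictMono hp).monotone h
    have h3 := start_phase_le (p := p) (w := w) t
    have hk := h1.le_k
    have h4 := h1.start_ge (by omega)
    have h5 : p.d * p.s ((state p w (p.K + 3)).k - 1) ≤ p.T := by omega
    have h6 : (p.d * p.s ((state p w (p.K + 3)).k - 1) : ℝ) ≤ p.T := by exact_mod_cast h5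
    have h7 := hp.lt_of_K
    have h8 := p.le_s ((state p w (p.K + 3)).k - 1)
    have hσ := hp.σ_pos
    have hd := hp.d_cast
    have hL := hp.one_le_L
    have h9 : (4 : ℝ) ^ (p.K + 2) ≤ 4 ^ ((state p w (p.K + 3)).k - 1) :=
      pow_le_pow_right₀ (by norm_num) (by omega)
    have h10 : 40 * p.σ ^ 2 * p.d * (2 * p.L) * (4 : ℝ) ^ (p.K + 1)
        ≤ p.d * p.s ((state p w (p.K + 3)).k - 1) := by
      calc 40 * p.σ ^ 2 * p.d * (2 * p.L) * (4 : ℝ) ^ (p.K + 1)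
          ≤ 40 * p.σ ^ 2 * p.d * (4 * p.L) * (4 : ℝ) ^ (p.K + 1) := by gcongr; norm_num
        _ = 1 * (40 * p.σ ^ 2 * p.d * p.L * (4 : ℝ) ^ (p.K + 2)) := by rw [pow_succ]; ring
        _ ≤ p.d * (40 * p.σ ^ 2 * p.d * p.L * (4 : ℝ) ^ ((state p w (p.K + 3)).k - 1)) := by
            gcongr
        _ ≤ _ := by gcongr
    linarith
  have h1 : regret p w ≤ ∑ _n ∈ Finset.range (p.K + 3),
      300 * p.Γ * (p.d * p.L * (√(p.M : ℝ) * √(p.T : ℝ))) := by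
    refine regret_le.trans ?_
    rw [← Finset.sum_fiberwise_of_maps_to hmaps, Finset.mul_sum]
    refine Finset.sum_le_sum fun n hn => ?_
    rw [Finset.mem_range] at hn
    exact phase_regret_le hp hT hθ (hI n hn.le) (hG n hn)
  refine h1.trans ?_
  rw [Finset.sum_const, Finset.card_range, nsmul_eq_mul]
  have hK := hp.K_le_log hT'
  have hK3 : ((p.K + 3 : ℕ) : ℝ) ≤ 16 * Real.log (9 * √((p.M : ℝ) * p.T)) := by
    have : (1 : ℝ) ≤ p.K := by exact_mod_cast hK1
    push_cast; linarith
  have hΓ := p.one_le_Γ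
  calc _ ≤ 16 * Real.log (9 * √((p.M : ℝ) * p.T)) *
        (300 * p.Γ * (p.d * p.L * (√(p.M : ℝ) * √(p.T : ℝ)))) := by gcongr
    _ = _ := by rw [Real.sqrt_mul (by positivity), Params.Γ]; ring

end


/-! ### Unbiasedness and concentration of the stochastic quantizer -/

theorem stoQuant_eq_indicator (u y ε r : ℝ) : stoQuant u y ε r = gridPt ε r (cell y ε r + 1) +
    (Set.Iio ((gridPt ε r (cell y ε r + 1) - y) /
      (gridPt ε r (cell y ε r + 1) - gridPt ε r (cell y ε r)))).indicator
      (fun _ => gridPt ε r (cell y ε r) - gridPt ε r (cell y ε r + 1)) u := by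
  rw [stoQuant, Set.indicator]
  simp only [Set.mem_Iio]
  split_ifs <;> ring

theorem measurable_gridPt {α : Type*} [MeasurableSpace α] {f : α → ℕ} (hf : Measurable f)
    (ε r : ℝ) : Measurable fun a => gridPt ε r (f a) :=
  (measurable_of_countable (fun m => gridPt ε r m)).comp hf

theorem measurable_cell {α : Type*} [MeasurableSpace α] {f : α → ℝ} (hf : Measurable f)
    (ε r : ℝ) : Measurable fun a => cell (f a) ε r := by
  unfold cell
  exact measurable_const.min (Nat.measurable_floor.comp (by fun_prop))

theorem measurable_stoQuant {α : Type*} [MeasurableSpace α] {u y : α → ℝ} (hu : Measurable u)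
    (hy : Measurable y) (ε r : ℝ) : Measurable fun a => stoQuant (u a) (y a) ε r := by
  have h1 := measurable_gridPt (measurable_cell hy ε r) ε r
  have h2 := measurable_gridPt ((measurable_cell hy ε r).add_const 1) ε r
  unfold stoQuant
  exact Measurable.ite (measurableSet_lt hu ((h2.sub hy).div (h2.sub h1))) h1 h2

theorem measurable_detQuant {α : Type*} [MeasurableSpace α] {y : α → ℝ}
    (hy : Measurable y) (ε r : ℝ) : Measurable fun a => detQuant (y a) ε r := by
  have h1 := measurable_gridPt (measurable_cell hy ε r) ε r
  have h2 := measurable_gridPt ((measurable_cell hy ε r).add_const 1) ε r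
  unfold detQuant
  exact Measurable.ite (measurableSet_lt (h1.sub hy).abs (h2.sub hy).abs) h1 h2

theorem stoQuant_sub_mem {u y ε r : ℝ} (hε : 0 < ε) (hr : 0 < r) :
    stoQuant u y ε r - y ∈ Set.Icc (gridPt ε r (cell y ε r) - y)
      (gridPt ε r (cell y ε r + 1) - y) := by
  have := gridPt_width_pos hε hr (cell y ε r)
  rw [stoQuant]
  split_ifs <;> constructor <;> linarith

/-- The lower end is chosen with the probability that makes the mean equal to `y`. The condition
`|y| ≤ r` puts this threshold in `[0, 1]`, where the uniform law of the seed reproduces it exactly.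
-/
theorem integral_stoQuant_sub {Ω : Type*} [MeasurableSpace Ω] {P : Measure Ω}
    [IsProbabilityMeasure P] {u : Ω → ℝ} (hu : Measurable u)
    (hunif : pdf.IsUniform u (Set.Icc (0 : ℝ) 1) P) {y ε r : ℝ} (hε : 0 < ε) (hr : 0 < r)
    (hy : |y| ≤ r) : ∫ ω, (stoQuant (u ω) y ε r - y) ∂P = 0 := by
  obtain ⟨h1, h2⟩ := cell_mem hε hr hy
  have hw := gridPt_width_pos hε hr (cell y ε r)
  set lo := gridPt ε r (cell y ε r) with hlo
  set hi := gridPt ε r (cell y ε r + 1) with hhi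
  set q := (hi - y) / (hi - lo) with hq
  have hq0 : 0 ≤ q := div_nonneg (by linarith) hw.le
  have hq1 : q ≤ 1 := (div_le_one hw).2 (by linarith)
  have hP : P.real (u ⁻¹' Set.Iio q) = q := by
    rw [← map_measureReal_apply hu measurableSet_Iio, hunif, ProbabilityTheory.cond]
    simp only [Real.volume_Icc, sub_zero, ENNReal.ofReal_one, inv_one, one_smul]
    rw [measureReal_restrict_apply measurableSet_Iio]
    have : Set.Iio q ∩ Set.Icc 0 1 = Set.Ico 0 q := by
      ext x; simp only [Set.mem_inter_iff, Set.mem_Iio, Set.mem_Icc, Set.mem_Ico]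
      constructor
      · rintro ⟨a, b, c⟩; exact ⟨b, a⟩
      · rintro ⟨a, b⟩; exact ⟨b, a, by linarith⟩
    rw [this, Real.volume_real_Ico_of_le hq0, sub_zero]
  have e : ∀ ω, stoQuant (u ω) y ε r - y
      = (hi - y) + (u ⁻¹' Set.Iio q).indicator (fun _ => lo - hi) ω := by
    intro ω
    rw [stoQuant_eq_indicator, ← hlo, ← hhi, ← hq]
    simp only [Set.indicator, Set.mem_preimage]
    ring
  simp_rw [e]
  rw [integral_add (integrable_const _) ((integrable_const _).indicator (hu measurableSet_Iio)),
    integral_indicator_const _ (hu measurableSet_Iio), hP]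
  simp only [integral_const, probReal_univ, smul_eq_mul, one_mul]
  rw [hq]; field_simp; ring

/-- Two-sided sub-Gaussian tail of a finite sum of independent variables. -/
theorem measure_abs_sum_gt_le {Ω ι : Type*} [MeasurableSpace Ω] {P : Measure Ω}
    [IsProbabilityMeasure P] {X : ι → Ω → ℝ} (hX : iIndepFun X P) {c : NNReal} {s : Finset ι}
    (hc : ∀ i ∈ s, HasSubgaussianMGF (X i) c P) {v x t : ℝ} (ht : 0 ≤ t)
    (hpos : 0 < s.card * (c : ℝ)) (hv : s.card * (c : ℝ) ≤ v) (hx : 2 * v * x ≤ t ^ 2) :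
    P {ω | t < |∑ i ∈ s, X i ω|} ≤ ENNReal.ofReal (2 * Real.exp (-x)) := by
  have hsub := HasSubgaussianMGF.sum_of_iIndepFun hX (s := s) (c := fun _ => c) hc
  rw [Finset.sum_const, nsmul_eq_mul] at hsub
  -- For `x ≤ 0` the claimed bound exceeds 1.
  rcases le_or_gt x 0 with hx0 | hx0
  · refine prob_le_one.trans ?_
    rw [ENNReal.one_le_ofReal]
    have := Real.one_le_exp (neg_nonneg.2 hx0)
    linarith
  have hexp : ∀ {Y : Ω → ℝ}, HasSubgaussianMGF Y (s.card * c) P →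
      P.real {ω | t ≤ Y ω} ≤ Real.exp (-x) := by
    intro Y hY
    refine (hY.measure_ge_le ht).trans (Real.exp_le_exp.2 ?_)
    push_cast
    rw [neg_div, neg_le_neg_iff, le_div_iff₀ (by positivity)]
    nlinarith
  have h1 := hexp hsub
  have h2 := hexp hsub.neg
  have hsubset : {ω | t < |∑ i ∈ s, X i ω|} ⊆
      {ω | t ≤ ∑ i ∈ s, X i ω} ∪ {ω | t ≤ (-fun ω => ∑ i ∈ s, X i ω) ω} := by
    intro ω hω
    rw [Set.mem_ofPred_eq] at hω
    rcases lt_abs.1 hω with h | h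
    · exact Or.inl h.le
    · exact Or.inr h.le
  have h3 : P.real {ω | t < |∑ i ∈ s, X i ω|} ≤ 2 * Real.exp (-x) := by
    refine (measureReal_mono hsubset).trans ((measureReal_union_le _ _).trans ?_)
    linarith
  rw [← ofReal_measureReal]
  exact ENNReal.ofReal_le_ofReal h3

/-- Concentration of the total error of stochastically quantizing `M` numbers. -/
theorem measure_stoQuant_error_le {Ω : Type*} [MeasurableSpace Ω] {P : Measure Ω}
    [IsProbabilityMeasure P] {M : ℕ} {u : Fin M → Ω → ℝ} (hu : ∀ j, Measurable (u j))
    (hind : iIndepFun u P) (hunif : ∀ j, pdf.IsUniform (u j) (Set.Icc (0 : ℝ) 1) P)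
    {y : Fin M → ℝ} {ε r : ℝ} (hε : 0 < ε) (hr : 0 < r) (hy : ∀ j, |y j| ≤ r) (hM : 1 ≤ M)
    {x t : ℝ} (ht : 0 ≤ t) (hx : 2 * (M * (ε / 2) ^ 2) * x ≤ t ^ 2) :
    P {ω | t < |∑ j, (stoQuant (u j ω) (y j) ε r - y j)|}
      ≤ ENNReal.ofReal (2 * Real.exp (-x)) := by
  have hM' : (1 : ℝ) ≤ M := by exact_mod_cast hM
  have hl' : (0 : ℝ) < numCells ε r := by exact_mod_cast numCells_pos hε hr
  have hw0 : 0 < 2 * r / (numCells ε r : ℝ) := by positivity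
  have hwε : 2 * r / numCells ε r ≤ ε := by
    rw [← gridPt_succ_sub hε hr 0]; exact gridPt_width_le hε hr 0
  -- By Hoeffding's lemma, a centred variable confined to one cell has sub-Gaussian parameter the
  -- square of half the cell width, and that width is at most `ε`.
  refine measure_abs_sum_gt_le (s := Finset.univ) (X := fun j ω => stoQuant (u j ω) (y j) ε r - y j)
    (c := (‖2 * r / numCells ε r‖₊ / 2) ^ 2) ?_ (fun j _ => ?_) ht ?_ ?_ hx
  · exact hind.comp (fun j a => stoQuant a (y j) ε r - y j) fun j =>
      (measurable_stoQuant measurable_id measurable_const ε r).sub_const _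
  · have h := hasSubgaussianMGF_of_mem_Icc_of_integral_eq_zero (μ := P)
      (X := fun ω => stoQuant (u j ω) (y j) ε r - y j)
      ((measurable_stoQuant (hu j) measurable_const ε r).sub_const _).aemeasurable
      (ae_of_all _ fun ω => stoQuant_sub_mem hε hr)
      (integral_stoQuant_sub (hu j) (hunif j) hε hr (hy j))
    have e : gridPt ε r (cell (y j) ε r + 1) - y j - (gridPt ε r (cell (y j) ε r) - y j)
        = 2 * r / numCells ε r := by
      rw [← gridPt_succ_sub hε hr (cell (y j) ε r)]; ring
    rwa [e] at h
  · push_cast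
    rw [Finset.card_univ, Fintype.card_fin, Real.norm_of_nonneg hw0.le]
    positivity
  · push_cast
    rw [Finset.card_univ, Fintype.card_fin, Real.norm_of_nonneg hw0.le]
    gcongr


section

/-! ### The run as a function of the randomness -/

/-- Index set of the noise variables and quantization seeds. -/
abbrev Source (d M : ℕ) : Type := (Fin M × ℕ) ⊕ (Fin M × ℕ × Fin d)

/-- The world with given realization of the noise and the seeds. -/
def worldOf {d M : ℕ} (θ : E d) (b : OrthonormalBasis (Fin d) ℝ (E d)) (z : Source d M → ℝ) :
    World d M where
  θ := θ
  basis := b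
  noise j t := z (Sum.inl (j, t))
  seed j n i := z (Sum.inr (j, n, i))

variable (p : Params) (θ : E p.d) (b : OrthonormalBasis (Fin p.d) ℝ (E p.d))

/-- The state at the beginning of phase `n`, as a function of the randomness. -/
noncomputable abbrev stateOf (n : ℕ) (z : Source p.d p.M → ℝ) : State p.d :=
  state p (worldOf θ b z) n

variable {p θ b}

theorem localEstimate_congr {S : State p.d} {z z' : Source p.d p.M → ℝ}
    (h : ∀ j t, t < S.start + p.d * p.s S.k → z (Sum.inl (j, t)) = z' (Sum.inl (j, t)))
    (j : Fin p.M) :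
    localEstimate p (worldOf θ b z) S j = localEstimate p (worldOf θ b z') S j := by
  simp only [localEstimate, World.reward, worldOf]
  refine Finset.sum_congr rfl fun i _ => ?_
  congr 2
  refine Finset.sum_congr rfl fun m hm => ?_
  rw [h]
  rw [Finset.mem_range] at hm
  have : ((i : ℕ) + 1) * p.s S.k ≤ p.d * p.s S.k := Nat.mul_le_mul_right _ i.2
  rw [Nat.add_mul] at this
  omega

/-- The start of a phase is a stopping time: agreement of the noise up to the start computed from
`z` alone suffices. By induction, each phase reads only noise before its end and the seeds of its
own messages. -/
theorem stateOf_congr {n : ℕ} {z z' : Source p.d p.M → ℝ}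
    (hnoise : ∀ j t, t < (stateOf p θ b n z).start → z (Sum.inl (j, t)) = z' (Sum.inl (j, t)))
    (hseed : ∀ j m i, m < n → z (Sum.inr (j, m, i)) = z' (Sum.inr (j, m, i))) :
    stateOf p θ b n z' = stateOf p θ b n z := by
  induction n with
  | zero => rfl
  | succ n ih =>
    have hstart := start_add_le (p := p) (w := worldOf θ b z) n
    have ih' := ih (fun j t ht => hnoise j t (ht.trans_le ((Nat.le_add_right _ _).trans hstart)))
      fun j m i hm => hseed j m i (by omega)
    change step p (worldOf θ b z') n (stateOf p θ b n z')
      = step p (worldOf θ b z) n (stateOf p θ b n z)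
    rw [ih']
    have hup : uplink p (worldOf θ b z') n (stateOf p θ b n z)
        = uplink p (worldOf θ b z) n (stateOf p θ b n z) := by
      funext j
      rw [uplink, uplink, localEstimate_congr (z := z) (z' := z')
        fun j t ht => hnoise j t (lt_of_lt_of_le ht hstart)]
      congr 1
      funext i
      exact (hseed j n i (Nat.lt_succ_self n)).symm
    have hse : serverEstimate p (worldOf θ b z') n (stateOf p θ b n z)
        = serverEstimate p (worldOf θ b z) n (stateOf p θ b n z) := by
      simp only [serverEstimate, hup]
    have hdl : downlink p (worldOf θ b z') n (stateOf p θ b n z)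
        = downlink p (worldOf θ b z) n (stateOf p θ b n z) := by
      simp only [downlink, hse]
    simp only [step, hse, hdl]

/-! ### Measurability of the run -/

instance : MeasurableSpace (Option ℕ) := ⊤

instance : DiscreteMeasurableSpace (Option ℕ) := ⟨fun _ => trivial⟩

/-- The components of a state that range over countable sets. -/
def State.disc {d : ℕ} (S : State d) : ℕ × ℕ × Option ℕ := (S.k, S.start, S.k₀)

/-- A state-valued map with measurable components. -/
structure MeasurableState {α : Type*} [MeasurableSpace α] {d : ℕ} (f : α → State d) : Prop where
  disc : Measurable fun a => (f a).disc
  θbar : Measurable fun a => (f a).θbar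
  μ₀ : Measurable fun a => (f a).μ₀

/-- A map is measurable if it is so after freezing a countably valued measurable argument. -/
theorem measurable_of_freeze {α β ι : Type*} [MeasurableSpace α] [MeasurableSpace β]
    [MeasurableSpace ι] [Countable ι] [MeasurableSingletonClass ι] {c : α → ι}
    (hc : Measurable c) {f : ι → α → β} (hf : ∀ i, Measurable (f i)) :
    Measurable fun a => f (c a) a :=
  (measurable_from_prod_countable_right (f := fun q : ι × α => f q.1 q.2) hf).comp
    (hc.prodMk measurable_id)

theorem measurable_euclidean_iff {α : Type*} [MeasurableSpace α] {d : ℕ} {f : α → E d} :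
    Measurable f ↔ ∀ i, Measurable fun a => f a i := by
  constructor
  · intro h i; fun_prop
  · intro h
    exact (WithLp.measurable_toLp 2 (Fin d → ℝ)).comp (measurable_pi_iff.2 h)

theorem measurable_clip {α : Type*} [MeasurableSpace α] {d : ℕ} {f : α → E d}
    (hf : Measurable f) (r : ℝ) : Measurable fun a => PLS.clip (f a) r := by
  unfold PLS.clip
  exact (measurable_const.min (measurable_const.div hf.norm)).smul hf

variable {α : Type*} [MeasurableSpace α] {z : α → Source p.d p.M → ℝ} {S : α → State p.d}

theorem measurable_localEstimate (hz : Measurable z) {k st : ℕ} (hk : ∀ a, (S a).k = k)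
    (hst : ∀ a, (S a).start = st) (j : Fin p.M) :
    Measurable fun a => localEstimate p (worldOf θ b (z a)) (S a) j := by
  simp only [localEstimate, World.reward, worldOf, hk, hst]
  refine Finset.measurable_fun_sum _ fun i _ => Measurable.smul_const ?_ _
  refine Measurable.div_const (Finset.measurable_fun_sum _ fun m _ => ?_) _
  exact measurable_const.add ((measurable_pi_apply _).comp hz)

theorem measurable_clipped (hz : Measurable z) (hθ : Measurable fun a => (S a).θbar) {k st : ℕ}
    (hk : ∀ a, (S a).k = k) (hst : ∀ a, (S a).start = st) (j : Fin p.M) :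
    Measurable fun a => clipped p (worldOf θ b (z a)) (S a) j := by
  simp only [clipped, hk]
  exact measurable_clip ((measurable_localEstimate hz hk hst j).sub hθ) _

theorem measurable_serverEstimate (hz : Measurable z) (hθ : Measurable fun a => (S a).θbar)
    {k st : ℕ} (hk : ∀ a, (S a).k = k) (hst : ∀ a, (S a).start = st) (n : ℕ) :
    Measurable fun a => serverEstimate p (worldOf θ b (z a)) n (S a) := by
  simp only [serverEstimate]
  refine hθ.add (Measurable.fun_const_smul (Finset.measurable_fun_sum _ fun j _ => ?_) _)
  rw [measurable_euclidean_iff]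
  intro i
  simp only [uplink, stoQuantVec, hk, worldOf]
  refine measurable_stoQuant ((measurable_pi_apply _).comp hz) ?_ _ _
  have := measurable_clipped (θ := θ) (b := b) hz hθ hk hst j
  simp only [clipped, hk] at this
  exact measurable_euclidean_iff.1 this i

theorem measurable_downlink (hz : Measurable z) (hθ : Measurable fun a => (S a).θbar)
    {k st : ℕ} (hk : ∀ a, (S a).k = k) (hst : ∀ a, (S a).start = st) (n : ℕ) :
    Measurable fun a => downlink p (worldOf θ b (z a)) n (S a) := by
  rw [measurable_euclidean_iff]
  intro i
  simp only [downlink, detQuantVec, hk]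
  exact measurable_detQuant (measurable_euclidean_iff.1
    ((measurable_serverEstimate hz hθ hk hst n).sub hθ) i) _ _

/-- Once index, start and stage are constant, the noise variables that are read and the branch of
`step` no longer vary, and each component is an explicit measurable expression. -/
theorem measurableState_step_of_frozen (hz : Measurable z) (hS : MeasurableState S)
    {c : ℕ × ℕ × Option ℕ} (hc : ∀ a, (S a).disc = c) (n : ℕ) :
    MeasurableState fun a => step p (worldOf θ b (z a)) n (S a) := by
  obtain ⟨k, st, o⟩ := c
  have hk : ∀ a, (S a).k = k := fun a => congrArg Prod.fst (hc a)
  have hst : ∀ a, (S a).start = st := fun a => congrArg (fun x => x.2.1) (hc a)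
  have ho : ∀ a, (S a).k₀ = o := fun a => congrArg (fun x => x.2.2) (hc a)
  have hse := measurable_serverEstimate (θ := θ) (b := b) hz hS.θbar hk hst n
  have hdl := measurable_downlink (θ := θ) (b := b) hz hS.θbar hk hst n
  cases o with
  | none =>
    have hset : MeasurableSet {a | p.τ k ≤ 1 / 4 * ‖serverEstimate p (worldOf θ b (z a)) n (S a)‖} :=
      measurableSet_le measurable_const (hse.norm.const_mul _)
    refine ⟨?_, ?_, ?_⟩ <;> simp only [step, State.disc, ho, hk, hst]
    · exact (Measurable.ite hset measurable_const measurable_const).prodMk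
        (measurable_const.prodMk (Measurable.ite hset measurable_const measurable_const))
    · exact measurable_const
    · exact measurable_const
  | some k₀ =>
    have hμ : Measurable fun a => if k = k₀ then
        ‖(S a).θbar + downlink p (worldOf θ b (z a)) n (S a)‖ else (S a).μ₀ := by
      split_ifs
      · exact (hS.θbar.add hdl).norm
      · exact hS.μ₀
    refine ⟨?_, ?_, ?_⟩ <;> simp only [step, State.disc, ho, hk, hst]
    · refine measurable_const.prodMk (Measurable.prodMk ?_ measurable_const)
      refine measurable_const.add ?_
      unfold Params.t
      exact Nat.measurable_ceil.comp (measurable_const.mul (hμ.pow_const 2))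
    · exact hS.θbar.add hdl
    · exact hμ

theorem measurableState_step (hz : Measurable z) (hS : MeasurableState S) (n : ℕ) :
    MeasurableState fun a => step p (worldOf θ b (z a)) n (S a) := by
  have key : ∀ c : ℕ × ℕ × Option ℕ, MeasurableState fun a => step p (worldOf θ b (z a)) n
      { k := c.1, start := c.2.1, k₀ := c.2.2, θbar := (S a).θbar, μ₀ := (S a).μ₀ } := fun c =>
    measurableState_step_of_frozen (S := fun a => ⟨c.1, c.2.1, c.2.2, (S a).θbar, (S a).μ₀⟩) hz
      ⟨measurable_const (a := c), hS.θbar, hS.μ₀⟩ (c := c) (fun _ => rfl) n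
  exact ⟨measurable_of_freeze hS.disc fun c => (key c).disc,
    measurable_of_freeze hS.disc fun c => (key c).θbar,
    measurable_of_freeze hS.disc fun c => (key c).μ₀⟩

theorem measurableState_stateOf (n : ℕ) : MeasurableState (stateOf p θ b n) := by
  induction n with
  | zero =>
    exact ⟨measurable_const (a := (1, 0, none)), measurable_const (a := 0),
      measurable_const (a := 0)⟩
  | succ n ih => exact measurableState_step measurable_id ih n

/-! ### Independence of disjoint groups of sources -/

theorem measurable_indicator_apply {ι : Type*} (T : Set ι) :
    Measurable fun z : ι → ℝ => T.indicator z := by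
  classical
  refine measurable_pi_iff.2 fun i => ?_
  by_cases h : i ∈ T
  · simpa [h] using measurable_pi_apply i
  · simp [h]

/-- Groups of sources are represented by zeroing the others rather than by restriction, so that the
run can be evaluated directly on a truncated source vector. -/
theorem indepFun_indicator {Ω ι : Type*} [MeasurableSpace Ω] {P : Measure Ω} {X : ι → Ω → ℝ}
    (hX : ∀ i, Measurable (X i)) (hind : iIndepFun X P) {T T' : Set ι} (hT : Disjoint T T') :
    IndepFun (fun ω => T.indicator fun i => X i ω) (fun ω => T'.indicator fun i => X i ω) P := by
  classical
  have key : ∀ T : Set ι, MeasurableSpace.comap (fun ω => T.indicator fun i => X i ω) inferInstance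
      ≤ ⨆ i ∈ T, MeasurableSpace.comap (X i) inferInstance := by
    intro T
    refine Measurable.comap_le (@measurable_pi_iff _ _ _ (_) _ _ |>.2 fun i => ?_)
    by_cases h : i ∈ T
    · simp only [Set.indicator_of_mem h]
      exact (comap_measurable (X i)).mono (le_iSup₂_of_le i h le_rfl) le_rfl
    · simp only [Set.indicator_of_notMem h]
      exact measurable_const
  have h := indep_iSup_of_disjoint (fun i => (hX i).comap_le) hind hT
  exact indep_of_indep_of_le_left (indep_of_indep_of_le_right h (key T')) (key T)

end


/-! ### Probability of a good run -/

/-- If an event is, given each value of a countable variable, contained in an independent event of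
probability at most `ε`, then its probability is at most `ε`. -/
theorem measure_le_of_countable_split {Ω ι α β : Type*} [MeasurableSpace Ω] [MeasurableSpace α]
    [MeasurableSpace β] [Countable ι] {P : Measure Ω} [IsProbabilityMeasure P] {s : Set Ω}
    {ε : ENNReal} {c : Ω → ι} {Y : ι → Ω → α} {V : ι → Ω → β}
    (hYV : ∀ i, IndepFun (Y i) (V i) P) (hY : ∀ i, Measurable (Y i))
    {A : ι → Set α} {B : ι → Set β} (hA : ∀ i, MeasurableSet (A i)) (hB : ∀ i, MeasurableSet (B i))
    (hcA : ∀ i ω, c ω = i ↔ Y i ω ∈ A i) (hsB : ∀ ω ∈ s, V (c ω) ω ∈ B (c ω))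
    (hε : ∀ i, P (V i ⁻¹' B i) ≤ ε) : P s ≤ ε := by
  have h1 : s ⊆ ⋃ i, (Y i ⁻¹' A i ∩ V i ⁻¹' B i) := fun ω hω =>
    Set.mem_iUnion.2 ⟨c ω, (hcA _ ω).1 rfl, hsB ω hω⟩
  have hdisj : Pairwise (Function.onFun Disjoint fun i => Y i ⁻¹' A i) := by
    intro i i' hii
    refine Set.disjoint_left.2 fun ω h h' => hii ?_
    rw [← (hcA i ω).2 h, (hcA i' ω).2 h']
  calc P s ≤ P (⋃ i, (Y i ⁻¹' A i ∩ V i ⁻¹' B i)) := measure_mono h1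
    _ ≤ ∑' i, P (Y i ⁻¹' A i ∩ V i ⁻¹' B i) := measure_iUnion_le _
    -- Independence makes the bound `ε` uniform over the cases; the weights of the cases add up to
    -- at most 1.
    _ = ∑' i, P (Y i ⁻¹' A i) * P (V i ⁻¹' B i) := by
        congr 1; funext i
        exact (hYV i).measure_inter_preimage_eq_mul _ _ (hA i) (hB i)
    _ ≤ ∑' i, P (Y i ⁻¹' A i) * ε := ENNReal.tsum_le_tsum fun i => by gcongr; exact hε i
    _ = (∑' i, P (Y i ⁻¹' A i)) * ε := ENNReal.tsum_mul_right
    _ = P (⋃ i, Y i ⁻¹' A i) * ε := by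
        rw [measure_iUnion hdisj fun i => hY i (hA i)]
    _ ≤ 1 * ε := by gcongr; exact prob_le_one
    _ = ε := one_mul ε

section

variable {p : Params} {θ : E p.d} {b : OrthonormalBasis (Fin p.d) ℝ (E p.d)}
  {Ω : Type*} [MeasurableSpace Ω] {P : Measure Ω} {η : Fin p.M → ℕ → Ω → ℝ}
  {U : Fin p.M → ℕ → Fin p.d → Ω → ℝ}

/-- The family of all noise variables and seeds. -/
def sources {d M : ℕ} (η : Fin M → ℕ → Ω → ℝ) (U : Fin M → ℕ → Fin d → Ω → ℝ) :
    Source d M → Ω → ℝ :=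
  Sum.elim (fun a => η a.1 a.2) (fun a => U a.1 a.2.1 a.2.2)

theorem IsRandomness.measurable_sources {d M : ℕ} {σ : ℝ} {η : Fin M → ℕ → Ω → ℝ}
    {U : Fin M → ℕ → Fin d → Ω → ℝ} (h : IsRandomness P σ η U) (i : Source d M) :
    Measurable (sources η U i) := by
  rcases i with a | a
  · exact h.measurable_noise _ _
  · exact h.measurable_seed _ _ _

/-- The sources on which the state at the beginning of phase `n` depends if the phase begins at
time `st`. -/
def past (d M n st : ℕ) : Set (Source d M) :=
  {i | Sum.elim (fun a => a.2 < st) (fun a => a.2.1 < n) i}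

/-- The noise of a group of agents over a block of plays is small. -/
theorem measure_noise_gt_le [IsProbabilityMeasure P] (hp : p.Valid)
    (h : IsRandomness P p.σ η U) (n : ℕ) (i : Fin p.d) {J : Finset (Fin p.M)} (hJ : J.Nonempty) :
    P {ω | p.σ * (p.dev (stateOf p θ b n fun a => sources η U a ω).k * √(J.card : ℝ)) <
      |∑ j ∈ J, noiseSum p (worldOf θ b fun a => sources η U a ω)
        (stateOf p θ b n fun a => sources η U a ω) j i|}
      ≤ ENNReal.ofReal (2 * Real.exp (-(5 / 4 * p.L))) := by
  classical
  have hσ := hp.σ_pos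
  have hL := hp.one_le_L
  have hJ0 : (0 : ℝ) < J.card := by exact_mod_cast hJ.card_pos
  -- the block of noise variables
  let F : ℕ × ℕ → Finset (Fin p.M × ℕ) := fun c =>
    J ×ˢ Finset.Ico (c.2 + (i : ℕ) * p.s c.1) (c.2 + (i : ℕ) * p.s c.1 + p.s c.1)
  let B : ℕ × ℕ → Set (Source p.d p.M → ℝ) := fun c =>
    {z | p.σ * (p.dev c.1 * √(J.card : ℝ)) < |∑ a ∈ F c, z (Sum.inl a)|}
  have hF : ∀ (S : State p.d) (z : Source p.d p.M → ℝ),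
      ∑ j ∈ J, noiseSum p (worldOf θ b z) S j i = ∑ a ∈ F (S.k, S.start), z (Sum.inl a) := by
    intro S z
    rw [Finset.sum_product]
    refine Finset.sum_congr rfl fun j _ => ?_
    rw [Finset.sum_Ico_eq_sum_range, Nat.add_sub_cancel_left]
    rfl
  -- The block begins no earlier than the phase, so deleting the past leaves it intact.
  have hFz : ∀ c (z : Source p.d p.M → ℝ), ∑ a ∈ F c, (past p.d p.M n c.2)ᶜ.indicator z (Sum.inl a)
      = ∑ a ∈ F c, z (Sum.inl a) := by
    intro c z
    refine Finset.sum_congr rfl fun a ha => Set.indicator_of_mem ?_ _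
    have := (Finset.mem_Ico.1 (Finset.mem_product.1 ha).2).1
    have hlt : ¬ a.2 < c.2 := by omega
    exact hlt
  have hstate : ∀ (st : ℕ) (z : Source p.d p.M → ℝ), (stateOf p θ b n z).start = st →
      stateOf p θ b n ((past p.d p.M n st).indicator z) = stateOf p θ b n z := by
    intro st z hst
    refine stateOf_congr (fun j t ht => ?_) fun j m i hm => ?_
    · rw [hst] at ht
      exact (Set.indicator_of_mem (show Sum.inl (j, t) ∈ past p.d p.M n st from ht) _).symm
    · exact (Set.indicator_of_mem (show Sum.inr (j, m, i) ∈ past p.d p.M n st from hm) _).symm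
  -- The converse of `hstate`: the start is now read off the truncated sources. Together they show
  -- that the event of a given index and start is determined by the past alone.
  have hstate' : ∀ (st : ℕ) (z : Source p.d p.M → ℝ),
      (stateOf p θ b n ((past p.d p.M n st).indicator z)).start = st →
      stateOf p θ b n ((past p.d p.M n st).indicator z) = stateOf p θ b n z := by
    intro st z hst
    refine (stateOf_congr (fun j t ht => ?_) fun j m i hm => ?_).symm
    · rw [hst] at ht
      exact Set.indicator_of_mem (show Sum.inl (j, t) ∈ past p.d p.M n st from ht) _
    · exact Set.indicator_of_mem (show Sum.inr (j, m, i) ∈ past p.d p.M n st from hm) _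
  have hdisc := (measurableState_stateOf (p := p) (θ := θ) (b := b) n).disc
  have hmeas : Measurable fun z => ((stateOf p θ b n z).k, (stateOf p θ b n z).start) :=
    (measurable_fst.comp hdisc).prodMk ((measurable_fst.comp measurable_snd).comp hdisc)
  have hX : Measurable fun ω a => sources η U a ω := measurable_pi_iff.2 h.measurable_sources
  refine measure_le_of_countable_split (ι := ℕ × ℕ)
    (c := fun ω => ((stateOf p θ b n fun a => sources η U a ω).k,
      (stateOf p θ b n fun a => sources η U a ω).start))
    (Y := fun c ω => (past p.d p.M n c.2).indicator fun a => sources η U a ω)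
    (V := fun c ω => (past p.d p.M n c.2)ᶜ.indicator fun a => sources η U a ω)
    (A := fun c => (fun z => ((stateOf p θ b n z).k, (stateOf p θ b n z).start)) ⁻¹' {c})
    (B := B)
    (fun c => indepFun_indicator h.measurable_sources h.indep disjoint_compl_right)
    (fun c => (measurable_indicator_apply _).comp hX)
    (fun c => hmeas (measurableSet_singleton c)) (fun c => ?_) (fun c ω => ?_) (fun ω hω => ?_)
    (fun c => ?_)
  · exact measurableSet_lt measurable_const
      (Finset.measurable_fun_sum (F c) fun a _ =>
        measurable_pi_apply (Sum.inl a : Source p.d p.M)).abs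
  · rw [Set.mem_preimage, Set.mem_singleton_iff]
    constructor
    · intro hc
      rw [hstate _ _ (congrArg Prod.snd hc)]; exact hc
    · intro hc
      rw [hstate' _ _ (congrArg Prod.snd hc)] at hc; exact hc
  · rw [Set.mem_ofPred_eq, hF] at hω
    rw [Set.mem_ofPred_eq, hFz]
    exact hω
  · have hind : iIndepFun (fun a : Fin p.M × ℕ => η a.1 a.2) P :=
      h.indep.precomp (g := Sum.inl) Sum.inl_injective
    have hcard : ((F c).card : ℝ) = J.card * p.s c.1 := by
      simp [F, Finset.card_product]
    have hs := hp.s_cast_pos c.1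
    have hsub := measure_abs_sum_gt_le hind (s := F c) (c := Real.toNNReal (p.σ ^ 2))
      (fun a _ => h.subgaussian _ _) (v := J.card * p.s c.1 * p.σ ^ 2) (x := 5 / 4 * p.L)
      (t := p.σ * (p.dev c.1 * √(J.card : ℝ))) (by unfold Params.dev; positivity)
      (by rw [hcard, Real.coe_toNNReal _ (by positivity)]; positivity)
      (by rw [hcard, Real.coe_toNNReal _ (by positivity)])
      -- With this threshold, `t² / (2 |J| s_k σ²) = (5/4) L`.
      (by
        rw [mul_pow, mul_pow, Params.dev, Real.sq_sqrt (by positivity), Real.sq_sqrt hJ0.le]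
        exact le_of_eq (by ring))
    refine le_trans (measure_mono fun ω hω => ?_) hsub
    rw [Set.mem_preimage, Set.mem_ofPred_eq, hFz] at hω
    exact hω

theorem clipped_congr {S : State p.d} {z z' : Source p.d p.M → ℝ}
    (h : ∀ j t, z (Sum.inl (j, t)) = z' (Sum.inl (j, t))) (j : Fin p.M) :
    clipped p (worldOf θ b z) S j = clipped p (worldOf θ b z') S j := by
  rw [clipped, clipped, localEstimate_congr fun j t _ => h j t]

/-- The quantization error of the server's average is small. -/
theorem measure_quant_gt_le [IsProbabilityMeasure P] (hp : p.Valid)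
    (h : IsRandomness P p.σ η U) (n : ℕ) (i : Fin p.d) :
    P {ω | p.σ * (p.dev (stateOf p θ b n fun a => sources η U a ω).k * √(p.M : ℝ)
        / (2 * p.s (stateOf p θ b n fun a => sources η U a ω).k)) <
      |∑ j, (uplink p (worldOf θ b fun a => sources η U a ω) n
          (stateOf p θ b n fun a => sources η U a ω) j i
        - clipped p (worldOf θ b fun a => sources η U a ω)
          (stateOf p θ b n fun a => sources η U a ω) j i)|}
      ≤ ENNReal.ofReal (2 * Real.exp (-(5 / 4 * p.L))) := by
  classical
  have hσ := hp.σ_pos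
  have hL := hp.one_le_L
  have hM := hp.M_cast
  have hd := hp.d_cast
  -- Only the seeds of message `n` are separated. All noise stays on the other side, so the state
  -- and the vectors to be quantized are functions of the complement.
  let T : Set (Source p.d p.M) := {a | Sum.elim (fun _ => False) (fun a => a.2.1 = n) a}
  let X : Ω → Source p.d p.M → ℝ := fun ω a => sources η U a ω
  have hX : Measurable X := measurable_pi_iff.2 h.measurable_sources
  let thr : ℕ → ℝ := fun k => p.σ * (p.dev k * √(p.M : ℝ) / (2 * p.s k))
  let err : (Source p.d p.M → ℝ) × (Source p.d p.M → ℝ) → Fin p.M → ℝ := fun q j =>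
    stoQuant (q.2 (Sum.inr (j, n, i))) (clipped p (worldOf θ b q.1) (stateOf p θ b n q.1) j i)
      (p.α (stateOf p θ b n q.1).k / √(p.d : ℝ))
      (p.R (stateOf p θ b n q.1).k + p.B (stateOf p θ b n q.1).k)
      - clipped p (worldOf θ b q.1) (stateOf p θ b n q.1) j i
  let D : Set ((Source p.d p.M → ℝ) × (Source p.d p.M → ℝ)) :=
    {q | thr (stateOf p θ b n q.1).k < |∑ j, err q j|}
  have hS := measurableState_stateOf (p := p) (θ := θ) (b := b) n
  have herr : ∀ j, Measurable fun q => err q j := by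
    intro j
    have hcl : ∀ c : ℕ × ℕ × Option ℕ, Measurable fun q : (Source p.d p.M → ℝ) ×
        (Source p.d p.M → ℝ) => clipped p (worldOf θ b q.1)
          ⟨c.1, c.2.1, c.2.2, (stateOf p θ b n q.1).θbar, (stateOf p θ b n q.1).μ₀⟩ j i := fun c =>
      measurable_euclidean_iff.1 (measurable_clipped measurable_fst
        (S := fun q : (Source p.d p.M → ℝ) × (Source p.d p.M → ℝ) =>
          ⟨c.1, c.2.1, c.2.2, (stateOf p θ b n q.1).θbar, (stateOf p θ b n q.1).μ₀⟩)
        (hS.θbar.comp measurable_fst) (k := c.1) (st := c.2.1) (fun _ => rfl) (fun _ => rfl) j) i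
    exact measurable_of_freeze (hS.disc.comp measurable_fst) fun c =>
      (measurable_stoQuant ((measurable_pi_apply _).comp measurable_snd) (hcl c)
        (p.α c.1 / √(p.d : ℝ)) (p.R c.1 + p.B c.1)).sub (hcl c)
  have hD : MeasurableSet D := by
    refine measurableSet_lt ?_ (Finset.measurable_fun_sum _ fun j _ => herr j).abs
    exact (measurable_of_countable thr).comp
      (measurable_fst.comp (hS.disc.comp measurable_fst))
  have hindep : IndepFun (fun ω => Tᶜ.indicator (X ω)) (fun ω => T.indicator (X ω)) P :=
    indepFun_indicator h.measurable_sources h.indep disjoint_compl_left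
  have hY : Measurable fun ω => Tᶜ.indicator (X ω) := (measurable_indicator_apply _).comp hX
  have hV : Measurable fun ω => T.indicator (X ω) := (measurable_indicator_apply _).comp hX
  have hmap := (indepFun_iff_map_prod_eq_prod_map_map hY.aemeasurable hV.aemeasurable).1 hindep
  have hVT : ∀ ω j, T.indicator (X ω) (Sum.inr (j, n, i)) = U j n i ω := fun ω j =>
    Set.indicator_of_mem (show Sum.inr (j, n, i) ∈ T from rfl) _
  have hev : {ω | thr (stateOf p θ b n (X ω)).k < |∑ j, (uplink p (worldOf θ b (X ω)) n
      (stateOf p θ b n (X ω)) j i - clipped p (worldOf θ b (X ω)) (stateOf p θ b n (X ω)) j i)|}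
      = (fun ω => (Tᶜ.indicator (X ω), T.indicator (X ω))) ⁻¹' D := by
    ext ω
    have hinl : ∀ j t, Tᶜ.indicator (X ω) (Sum.inl (j, t)) = X ω (Sum.inl (j, t)) := fun j t =>
      Set.indicator_of_mem (show Sum.inl (j, t) ∈ Tᶜ from fun hf => hf) _
    have hst : stateOf p θ b n (Tᶜ.indicator (X ω)) = stateOf p θ b n (X ω) := by
      refine stateOf_congr (fun j t _ => (hinl j t).symm) fun j m i hm => ?_
      exact (Set.indicator_of_mem
        (show Sum.inr (j, m, i) ∈ Tᶜ from fun hf => hm.ne hf) _).symm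
    have hcl : ∀ j, clipped p (worldOf θ b (Tᶜ.indicator (X ω))) (stateOf p θ b n (X ω)) j
        = clipped p (worldOf θ b (X ω)) (stateOf p θ b n (X ω)) j := clipped_congr hinl
    have hse : ∀ j, T.indicator (X ω) (Sum.inr (j, n, i)) = X ω (Sum.inr (j, n, i)) := fun j =>
      hVT ω j
    rw [Set.mem_preimage, Set.mem_ofPred_eq, Set.mem_ofPred_eq]
    simp only [err, hst, hcl, hse]
    rfl
  change P {ω | thr (stateOf p θ b n (X ω)).k < |∑ j, (uplink p (worldOf θ b (X ω)) n
      (stateOf p θ b n (X ω)) j i - clipped p (worldOf θ b (X ω)) (stateOf p θ b n (X ω)) j i)|} ≤ _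
  rw [hev, ← Measure.map_apply (hY.prodMk hV) hD, hmap, Measure.prod_apply hD]
  have hprob : IsProbabilityMeasure (P.map fun ω => Tᶜ.indicator (X ω)) :=
    Measure.isProbabilityMeasure_map hY.aemeasurable
  -- With all other sources fixed at `y`, the numbers to be quantized are deterministic and only the
  -- uniform seeds remain random.
  have hslice : ∀ y, (P.map fun ω => T.indicator (X ω)) (Prod.mk y ⁻¹' D)
      ≤ ENNReal.ofReal (2 * Real.exp (-(5 / 4 * p.L))) := by
    intro y
    rw [Measure.map_apply hV (measurable_prodMk_left hD)]
    set k := (stateOf p θ b n y).k with hk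
    have hs := hp.s_cast_pos k
    have hr : 0 < p.R k + p.B k := add_pos (p.R_pos k) (hp.B_pos k)
    have hα := hp.resolution_pos k
    have hq := hp.sqrt_M_pos
    have hind : iIndepFun (fun j => U j n i) P :=
      h.indep.precomp (g := fun j => Sum.inr (j, n, i)) fun j j' hj => by simpa using hj
    refine le_trans (measure_mono fun ω hω => ?_) (measure_stoQuant_error_le
      (fun j => h.measurable_seed j n i) hind (fun j => h.uniform_seed j n i)
      (y := fun j => clipped p (worldOf θ b y) (stateOf p θ b n y) j i)
      (ε := p.α k / √(p.d : ℝ)) (r := p.R k + p.B k) (by positivity) hr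
      (fun j => abs_clip_apply_le _ hr.le i) hp.M_pos (t := thr k)
      (by simp only [thr, Params.dev]; positivity) ?_)
    · rw [Set.mem_preimage, Set.mem_preimage, Set.mem_ofPred_eq] at hω
      simp only [err, hVT] at hω
      exact hω
    · have e1 : p.α k / √(p.d : ℝ) = p.α₀ * (p.σ / √(p.s k : ℝ)) := by
        have : 0 < √(p.d : ℝ) := Real.sqrt_pos.2 (by linarith)
        unfold Params.α; field_simp
      -- The threshold is exactly what resolution `σ / √s_k` would require; `α₀ < 1` makes the true
      -- resolution finer.
      have e2 : thr k ^ 2 = 2 * (p.M * ((p.σ / √(p.s k : ℝ)) / 2) ^ 2) * (5 / 4 * p.L) := by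
        simp only [thr, Params.dev, mul_pow, div_pow]
        rw [Real.sq_sqrt (by positivity), Real.sq_sqrt (by linarith), Real.sq_sqrt hs.le]
        field_simp
        norm_num
      rw [e1, e2]
      have hα1 := hp.α_lt
      have hα0 := hp.α_pos
      gcongr
      exact mul_le_of_le_one_left (by positivity) hα1.le
  calc _ ≤ ∫⁻ _y, ENNReal.ofReal (2 * Real.exp (-(5 / 4 * p.L)))
        ∂(P.map fun ω => Tᶜ.indicator (X ω)) := lintegral_mono fun y => hslice y
    _ = _ := by rw [lintegral_const, measure_univ, mul_one]

end


section

variable {p : Params} {θ : E p.d} {b : OrthonormalBasis (Fin p.d) ℝ (E p.d)}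
  {Ω : Type*} [MeasurableSpace Ω] {P : Measure Ω} {η : Fin p.M → ℕ → Ω → ℝ}
  {U : Fin p.M → ℕ → Fin p.d → Ω → ℝ}

theorem measure_not_goodPhase_le [IsProbabilityMeasure P] (hp : p.Valid)
    (h : IsRandomness P p.σ η U) (n : ℕ) :
    P {ω | ¬ GoodPhase p (worldOf θ b fun a => sources η U a ω) n}
      ≤ (p.M * p.d + p.d + p.d) * ENNReal.ofReal (2 * Real.exp (-(5 / 4 * p.L))) := by
  have hM : Nonempty (Fin p.M) := ⟨⟨0, hp.M_pos⟩⟩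
  set ε := ENNReal.ofReal (2 * Real.exp (-(5 / 4 * p.L)))
  set w : Ω → World p.d p.M := fun ω => worldOf θ b fun a => sources η U a ω
  set S : Ω → State p.d := fun ω => state p (w ω) n
  have h1 := fun j i => measure_noise_gt_le (θ := θ) (b := b) hp h n i (Finset.singleton_nonempty j)
  have h2 := fun i => measure_noise_gt_le (θ := θ) (b := b) hp h n i
    (Finset.univ_nonempty (α := Fin p.M))
  have h3 := fun i => measure_quant_gt_le (θ := θ) (b := b) hp h n i
  simp only [Finset.sum_singleton, Finset.card_singleton, Nat.cast_one, Real.sqrt_one,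
    mul_one] at h1
  simp only [Finset.card_univ, Fintype.card_fin] at h2
  have hsub : {ω | ¬ GoodPhase p (w ω) n} ⊆
      ((⋃ j, ⋃ i, {ω | p.σ * p.dev (S ω).k < |noiseSum p (w ω) (S ω) j i|}) ∪
      ⋃ i, {ω | p.σ * (p.dev (S ω).k * √(p.M : ℝ)) < |∑ j, noiseSum p (w ω) (S ω) j i|}) ∪
      ⋃ i, {ω | p.σ * (p.dev (S ω).k * √(p.M : ℝ) / (2 * p.s (S ω).k)) <
        |∑ j, (uplink p (w ω) n (S ω) j i - clipped p (w ω) (S ω) j i)|} := by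
    intro ω hω
    by_contra hcon
    simp only [Set.mem_union, Set.mem_iUnion, Set.mem_ofPred_eq, not_or, not_exists,
      not_lt] at hcon
    exact hω ⟨hcon.1.1, hcon.1.2, hcon.2⟩
  refine (measure_mono hsub).trans ((measure_union_le _ _).trans ?_)
  rw [add_mul, add_mul]
  refine add_le_add ((measure_union_le _ _).trans (add_le_add ?_ ?_)) ?_
  · refine (measure_iUnion_le _).trans ?_
    calc _ ≤ ∑' _j : Fin p.M, ∑' _i : Fin p.d, ε := ENNReal.tsum_le_tsum fun j =>
          (measure_iUnion_le _).trans (ENNReal.tsum_le_tsum fun i => h1 j i)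
      _ = p.M * p.d * ε := by
          simp only [tsum_fintype, Finset.sum_const, Finset.card_univ, Fintype.card_fin,
            nsmul_eq_mul, mul_assoc]
  · refine (measure_iUnion_le _).trans ?_
    calc _ ≤ ∑' _i : Fin p.d, ε := ENNReal.tsum_le_tsum fun i => h2 i
      _ = p.d * ε := by simp [tsum_fintype]
  · refine (measure_iUnion_le _).trans ?_
    calc _ ≤ ∑' _i : Fin p.d, ε := ENNReal.tsum_le_tsum fun i => h3 i
      _ = p.d * ε := by simp [tsum_fintype]

/-- The union runs over at most `4K` phases and `3Md` events in each. The factor `exp (-L) =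
δ/(8MK)` pays for everything but `3d`, which is paid by `exp (-L/4)` because `L ≥ log (8K) ≥ log
((3d)^4)`. The fourth power is where `81 d^4` comes from. -/
theorem Params.Valid.failure_le (hp : p.Valid) (hK : 81 * p.d ^ 4 ≤ p.K) :
    (p.K + 3 : ℝ) * ((p.M * p.d + p.d + p.d) * (2 * Real.exp (-(5 / 4 * p.L)))) ≤ p.δ := by
  have hd := hp.d_cast
  have hM := hp.M_cast
  have hδ := hp.δ_pos
  have hK1 : (1 : ℝ) ≤ p.K := by exact_mod_cast hp.one_le_K
  have hK' : (81 : ℝ) * p.d ^ 4 ≤ p.K := by exact_mod_cast hK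
  have hY := hp.eight_mul_le hp.one_le_K
  have e1 : Real.exp (-(5 / 4 * p.L)) = p.δ / (8 * p.M * p.K) * Real.exp (-(p.L / 4)) := by
    have : -(5 / 4 * p.L) = -p.L + -(p.L / 4) := by ring
    rw [this, Real.exp_add, Real.exp_neg p.L, Params.L, Real.exp_log (by positivity), inv_div]
  have e2 : 3 * (p.d : ℝ) * Real.exp (-(p.L / 4)) ≤ 1 := by
    rw [Real.exp_neg, ← div_eq_mul_inv, div_le_one (Real.exp_pos _),
      ← Real.log_le_iff_le_exp (by positivity)]
    have : Real.log ((3 * (p.d : ℝ)) ^ 4) ≤ p.L := by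
      refine Real.log_le_log (by positivity) (le_trans ?_ hY)
      rw [mul_pow]; norm_num; linarith
    rw [Real.log_pow] at this
    push_cast at this; linarith
  have h1 : (p.M * p.d + p.d + p.d : ℝ) ≤ 3 * (p.M * p.d) := by nlinarith
  calc (p.K + 3 : ℝ) * ((p.M * p.d + p.d + p.d) * (2 * Real.exp (-(5 / 4 * p.L))))
      ≤ (4 * p.K) * ((3 * (p.M * p.d)) * (2 * Real.exp (-(5 / 4 * p.L)))) := by
        gcongr; linarith
    _ = p.δ * (3 * p.d * Real.exp (-(p.L / 4))) := by rw [e1]; field_simp; norm_num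
    _ ≤ p.δ * 1 := by gcongr
    _ = p.δ := mul_one _

/-- With probability at least `1 - δ`, the first `K + 3` phases are good. -/
theorem measure_good_ge [IsProbabilityMeasure P] (hp : p.Valid) (h : IsRandomness P p.σ η U)
    (hK : 81 * p.d ^ 4 ≤ p.K) :
    1 - p.δ ≤ P.real {ω | ∀ n < p.K + 3, GoodPhase p (worldOf θ b fun a => sources η U a ω) n} := by
  set G := {ω | ∀ n < p.K + 3, GoodPhase p (worldOf θ b fun a => sources η U a ω) n}
  have hbad : P Gᶜ ≤ ENNReal.ofReal p.δ := by
    have hsub : Gᶜ ⊆ ⋃ n ∈ Finset.range (p.K + 3),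
        {ω | ¬ GoodPhase p (worldOf θ b fun a => sources η U a ω) n} := by
      intro ω hω
      simp only [G, Set.mem_compl_iff, Set.mem_ofPred_eq, not_forall] at hω
      obtain ⟨n, hn, hbad⟩ := hω
      exact Set.mem_biUnion (Finset.mem_range.2 hn) hbad
    refine (measure_mono hsub).trans ((measure_biUnion_finset_le _ _).trans ?_)
    refine (Finset.sum_le_sum fun n _ => measure_not_goodPhase_le hp h n).trans ?_
    rw [Finset.sum_const, Finset.card_range, nsmul_eq_mul]
    refine le_trans (le_of_eq ?_) (ENNReal.ofReal_le_ofReal (hp.failure_le hK))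
    generalize 2 * Real.exp (-(5 / 4 * p.L)) = x
    rw [ENNReal.ofReal_mul (by positivity), ENNReal.ofReal_mul (by positivity)]
    congr 2
    · rw [← ENNReal.ofReal_natCast]; push_cast; rfl
    · rw [ENNReal.ofReal_add (by positivity) (by positivity),
        ENNReal.ofReal_add (by positivity) (by positivity), ENNReal.ofReal_mul (by positivity)]
      simp only [ENNReal.ofReal_natCast]
  have hbad' : P.real Gᶜ ≤ p.δ := ENNReal.toReal_le_of_le_ofReal hp.δ_pos.le hbad
  have hone : (1 : ℝ) ≤ P.real G + P.real Gᶜ := by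
    rw [← probReal_univ (μ := P), ← Set.union_compl_self G]
    exact measureReal_union_le _ _
  linarith

end

end PLS

/-! ### The regret bound for all horizons -/

theorem theorem1 (σ α₀ β₀ : ℝ) (hσ : 0 < σ) (hα₀ : 0 < α₀) (hα₀' : α₀ < 1)
    (hβ₀ : 0 < β₀) (hβ₀' : β₀ < 1) :
    ∃ C : ℝ, 0 < C ∧
      ∀ (d M : ℕ) (δ : ℝ), 1 ≤ d → 1 ≤ M → 0 < δ → δ < 1 →
        ∃ f : ℕ → ℝ, f =O[atTop] (fun T : ℕ => Real.log (T : ℝ)) ∧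
          ∀ (T : ℕ), 1 ≤ T →
          ∀ (θ : EuclideanSpace ℝ (Fin d)), ‖θ‖ ≤ 1 →
          ∀ (basis : OrthonormalBasis (Fin d) ℝ (EuclideanSpace ℝ (Fin d)))
            (Ω : Type*) [MeasurableSpace Ω] (P : Measure Ω) [IsProbabilityMeasure P]
            (η : Fin M → ℕ → Ω → ℝ) (U : Fin M → ℕ → Fin d → Ω → ℝ),
            PLS.IsRandomness P σ η U →
            1 - δ ≤ P.real {ω : Ω |
              PLS.regret ⟨d, M, T, σ, δ, α₀, β₀⟩
                  ⟨θ, basis, fun j t => η j t ω, fun j n i => U j n i ω⟩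
                ≤ C * d * √((M : ℝ) * T)
                    * Real.log (8 * M * (PLS.Params.K ⟨d, M, T, σ, δ, α₀, β₀⟩ : ℝ) / δ)
                    * Real.log (9 * √((M : ℝ) * T))
                  + f T} := by
  refine ⟨4800 * (40 * σ ^ 2 + 1), by positivity, fun d M δ hd hM hδ hδ' => ?_⟩
  set K₀ : ℕ := 81 * d ^ 4 with hK₀
  -- Beyond `T₀` the bound on good runs applies and `K ≥ K₀`, since `K₀` then satisfies the
  -- inequality defining `K`. Neither `θ`, the basis nor the noise law enters.
  set T₀ : ℕ := max (M * d ^ 2) (max ⌈4 + 1 / (40 * σ ^ 2)⌉₊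
    ⌈40 * σ ^ 2 * d * Real.log (8 * M * K₀ / δ) * ((4 : ℝ) ^ K₀ - 4)⌉₊) with hT₀
  -- Below `T₀` the trivial regret bound `2MT` is charged to `f`. As `f` vanishes eventually, it is
  -- `O(log T)`.
  refine ⟨fun T => if T < T₀ then (M : ℝ) * ((T : ℝ) * 2) else 0, ?_, ?_⟩
  · refine (isBigO_zero _ atTop).congr' ?_ EventuallyEq.rfl
    filter_upwards [eventually_ge_atTop T₀] with T hT
    rw [if_neg (by omega)]
  intro T hT θ hθ basis Ω _ P _ η U hR
  set p : PLS.Params := ⟨d, M, T, σ, δ, α₀, β₀⟩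
  have hp : p.Valid := ⟨hd, hM, hσ, hδ, hδ', hα₀, hα₀', hβ₀, hβ₀'⟩
  rcases lt_or_ge T T₀ with hTT | hTT
  · have hone : 1 - δ ≤ P.real Set.univ := by
      rw [probReal_univ]; linarith
    refine hone.trans (measureReal_mono fun ω _ => ?_)
    simp only [Set.mem_ofPred_eq, if_pos hTT]
    have h1 : PLS.regret p ⟨θ, basis, fun j t => η j t ω, fun j n i => U j n i ω⟩
        ≤ M * (T * 2) := by
      refine PLS.regret_le.trans ?_
      change (M : ℝ) * _ ≤ _
      gcongr
      refine (Finset.sum_le_card_nsmul _ _ 2 fun t _ => (PLS.gap_le t).trans ?_).trans ?_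
      · change 2 * ‖θ‖ ≤ 2; linarith
      · rw [Finset.card_range, nsmul_eq_mul]
    have h2 : 0 ≤ Real.log (8 * M * (PLS.Params.K p : ℝ) / δ) := by
      have : 1 ≤ Real.log (8 * M * (PLS.Params.K p : ℝ) / δ) := hp.one_le_L
      linarith
    have h3 : 0 ≤ Real.log (9 * √((M : ℝ) * T)) := by
      refine Real.log_nonneg ?_
      have h4 : (1 : ℝ) ≤ M * T := by exact_mod_cast Nat.mul_pos hM hT
      have := Real.one_le_sqrt.2 h4
      linarith
    have h5 : 0 ≤ 4800 * (40 * σ ^ 2 + 1) * d * √((M : ℝ) * T)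
        * Real.log (8 * M * (PLS.Params.K p : ℝ) / δ) * Real.log (9 * √((M : ℝ) * T)) := by
      positivity
    linarith
  · have hT1 : M * d ^ 2 ≤ T := (le_max_left _ _).trans hTT
    have hT2 : 4 + 1 / (40 * σ ^ 2) ≤ T := by
      refine (Nat.le_ceil _).trans ?_
      exact_mod_cast (le_max_left _ _).trans ((le_max_right _ _).trans hTT)
    have hT3 : 40 * σ ^ 2 * d * Real.log (8 * M * K₀ / δ) * ((4 : ℝ) ^ K₀ - 4) ≤ T := by
      refine (Nat.le_ceil _).trans ?_
      exact_mod_cast (le_max_right _ _).trans ((le_max_right _ _).trans hTT)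
    have hK : 81 * p.d ^ 4 ≤ p.K := hp.le_K (Nat.mul_pos (by norm_num) (Nat.pow_pos hd)) hT3
    refine (PLS.measure_good_ge (θ := θ) (b := basis) hp hR hK).trans
      (measureReal_mono fun ω hω => ?_)
    simp only [Set.mem_ofPred_eq, if_neg hTT.not_gt, add_zero]
    exact PLS.regret_le_of_good hp hT1 hT2 hθ hω
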